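/- Let $d\in\mathbb N$ and let $\Omega\subset\mathbb{R}^d$ be a bounded connected Lipschitz domain with $\partial\Omega=\partial\Omega_{\mathrm{Dir}}\cup\partial\Omega_{\mathrm{flux}}$, where both parts are measurable and $\mathcal{H}^{d-1}(\partial\Omega_{\mathrm{Dir}})>0$. Let $\tilde f\in L^2(\Omega)$, $g_{\mathrm{flux}}\in L^2(\partial\Omega_{\mathrm{flux}})$, $\lambda>0$ and $K_{\max}\in\mathbb{R}$. Put $H^1_{\mathrm{Dir}}(\Omega)=\{q\in H^1(\Omega): q=0 \text{ on } \partial\Omega_{\mathrm{Dir}} \text{ in the sense of traces}\}$. Call a matrix field $\mathbb{K}\in (L^\infty(\Omega))^{d\times d}$ admissible if, for a.e. $x\in\Omega$, $\mathbb{K}(x)\xi\cdot\xi\ge\lambda|\xi|^2$ for all $\xi\in\mathbb{R}^d$ and $\|\mathbb{K}(x)\|_F\le K_{\max}$ (Frobenius norm). For an admissible $\mathbb{K}$, a solution to Darcy's equation is a pair $(v,p)\in L^2(\Omega)^d\times H^1_{\mathrm{Dir}}(\Omega)$ with $v=-\mathbb{K}\nabla p$ and $$\int_\Omega \mathbb{K}\nabla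 p\cdot\nabla q\,dx-\int_{\partial\Omega_{\mathrm{flux}}}g_{\mathrm{flux}}\,q\,d\mathcal{H}^{d-1}=\int_\Omega\tilde f q\,dx\qquad\text{for all } q\in H^1_{\mathrm{Dir}}(\Omega)$$ (the weak form of $-\nabla\cdot(\mathbb{K}\nabla p)=\tilde f$ in $\Omega$ with $\mathbb{K}\nabla p\cdot\nu=g_{\mathrm{flux}}$ on $\partial\Omega_{\mathrm{flux}}$ and $p=0$ on $\partial\Omega_{\mathrm{Dir}}$). Then for every admissible $\mathbb{K}$ a solution exists, and there is a constant $C$, depending only on $\lambda$, $K_{\max}$, $\Omega$ (with the given parts of its boundary), $g_{\mathrm{flux}}$ and $\tilde f$, such that for all admissible $\mathbb{K}_1,\mathbb{K}_2$ and all respective solutions $(v_1,p_1),(v_2,p_2)$, $$\|p_2-p_1\|_{H^1(\Omega)}\le C\,\|\mathbb{K}_2-\mathbb{K}_1\|_{L^\infty(\Omega)},\qquad \|v_2-v_1\|_{L^2(\Omega)}\le C\,\|\mathbb{K}_2-\mathbb{K}_1\|_{L^\infty(\Omega)},$$ where $\|\mathbb{K}\|_{L^\infty(\Omega)}=\operatorname{ess\,sup}_{x\in\Omega}\|\mathbb{K}(x)\|_F$.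 -/

import Mathlib

open MeasureTheory Filter Topology
open scoped NNReal ENNReal ContDiff InnerProductSpace

noncomputable section

/-- Euclidean space of dimension `d`. -/
abbrev Euc (d : ℕ) : Type := EuclideanSpace ℝ (Fin d)

/-- A set has Lipschitz boundary if, near every boundary point, it is the strict epigraph of a
Lipschitz function over the hyperplane orthogonal to some unit vector `e`. -/
def HasLipschitzBoundary {d : ℕ} (Ω : Set (Euc d)) : Prop :=
  ∀ x₀ ∈ frontier Ω, ∃ e : Euc d, ‖e‖ = 1 ∧ ∃ r : ℝ, 0 < r ∧
    ∃ (L : ℝ≥0) (γ : (ℝ ∙ e)ᗮ → ℝ), LipschitzWith L γ ∧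
      ∀ x ∈ Metric.ball x₀ r,
        (x ∈ Ω ↔ γ ((ℝ ∙ e)ᗮ.orthogonalProjectionOnto x) < ⟪e, x⟫_ℝ)

/-- A bounded connected Lipschitz domain (`IsConnected` includes non-emptiness). -/
structure IsBoundedLipschitzDomain {d : ℕ} (Ω : Set (Euc d)) : Prop where
  isOpen : IsOpen Ω
  isConnected : IsConnected Ω
  isBounded : Bornology.IsBounded Ω
  lipschitz : HasLipschitzBoundary Ω

/-- The `(d-1)`-dimensional Hausdorff measure on `ℝᵈ`, normalised so that it is the usual surface
measure. -/
def surfaceMeasure (d : ℕ) : Measure (Euc d) := μHE[d - 1]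

/-- `G` is a weak (distributional) gradient of `u` on the open set `Ω`. -/
structure HasWeakGradient {d : ℕ} (Ω : Set (Euc d)) (u : Euc d → ℝ) (G : Euc d → Euc d) :
    Prop where
  locallyIntegrableOn : LocallyIntegrableOn u Ω volume
  locallyIntegrableOn_grad : LocallyIntegrableOn G Ω volume
  integral_eq : ∀ φ : Euc d → ℝ, ContDiff ℝ ∞ φ → HasCompactSupport φ → tsupport φ ⊆ Ω →
    ∀ i : Fin d, ∫ x in Ω, u x * fderiv ℝ φ x (EuclideanSpace.single i 1) =
      - ∫ x in Ω, G x i * φ x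

open Classical in
/-- The weak gradient of `u` on `Ω` (unique up to null sets; `0` if there is none). -/
def weakGrad {d : ℕ} (Ω : Set (Euc d)) (u : Euc d → ℝ) : Euc d → Euc d :=
  if h : ∃ G, HasWeakGradient Ω u G then h.choose else 0

/-- The Sobolev space `H¹(Ω) = W^{1,2}(Ω)`. -/
def MemH1 {d : ℕ} (Ω : Set (Euc d)) (u : Euc d → ℝ) : Prop :=
  MemLp u 2 (volume.restrict Ω) ∧
    ∃ G, HasWeakGradient Ω u G ∧ MemLp G 2 (volume.restrict Ω)

/-- The norm of `H¹(Ω)`: `(‖u‖²_{L²} + ‖∇u‖²_{L²})^{1/2}`. Meaningful for `u ∈ H¹(Ω)`. -/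
def h1Norm {d : ℕ} (Ω : Set (Euc d)) (u : Euc d → ℝ) : ℝ≥0∞ :=
  (eLpNorm u 2 (volume.restrict Ω) ^ 2 +
    eLpNorm (weakGrad Ω u) 2 (volume.restrict Ω) ^ 2) ^ (1 / 2 : ℝ)

/-- `t ∈ L²(∂Ω)` is the boundary trace of `u ∈ H¹(Ω)`. The trace operator is the continuous
extension of the restriction `φ ↦ φ|_∂Ω` from functions smooth up to the boundary, so its graph is
the closure of the graph of this restriction. -/
def IsTrace {d : ℕ} (Ω : Set (Euc d)) (u t : Euc d → ℝ) : Prop :=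
  MemH1 Ω u ∧ MemLp t 2 ((surfaceMeasure d).restrict (frontier Ω)) ∧
    ∃ φ : ℕ → Euc d → ℝ, (∀ n, ContDiff ℝ ∞ (φ n)) ∧
      Tendsto (fun n => h1Norm Ω (φ n - u)) atTop (𝓝 0) ∧
      Tendsto (fun n => eLpNorm (φ n - t) 2 ((surfaceMeasure d).restrict (frontier Ω)))
        atTop (𝓝 0)

/-- `u ∈ H¹(Ω)` has trace `t` and this trace vanishes a.e. on the Dirichlet part `ΓD`, that is,
`u ∈ H¹_Dir(Ω)` with trace `t`. -/
def IsTraceVanishingOn {d : ℕ} (Ω ΓD : Set (Euc d)) (u t : Euc d → ℝ) : Prop :=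
  IsTrace Ω u t ∧ ∀ᵐ x ∂((surfaceMeasure d).restrict ΓD), t x = 0

/-- The Frobenius norm of a matrix. -/
def frobNorm {d : ℕ} (M : Matrix (Fin d) (Fin d) ℝ) : ℝ := √(∑ i, ∑ j, M i j ^ 2)

/-- The `L^∞(Ω)` norm of a matrix field, taken with respect to the Frobenius norm. -/
def matLinftyNorm {d : ℕ} (Ω : Set (Euc d)) (K : Euc d → Matrix (Fin d) (Fin d) ℝ) : ℝ≥0∞ :=
  eLpNorm (fun x => frobNorm (K x)) ∞ (volume.restrict Ω)

/-- Measurable matrix fields on `Ω` that are a.e. `lam`-coercive and a.e. bounded by `Kmax` in the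
Frobenius norm. -/
structure IsPermeability {d : ℕ} (Ω : Set (Euc d)) (lam Kmax : ℝ)
    (K : Euc d → Matrix (Fin d) (Fin d) ℝ) : Prop where
  aemeasurable : ∀ i j, AEMeasurable (fun x => K x i j) (volume.restrict Ω)
  coercive : ∀ᵐ x ∂(volume.restrict Ω), ∀ ξ : Euc d,
    lam * ‖ξ‖ ^ 2 ≤ ⟪(K x).toEuclideanLin ξ, ξ⟫_ℝ
  bounded : ∀ᵐ x ∂(volume.restrict Ω), frobNorm (K x) ≤ Kmax

/-- `(v, p) ∈ L²(Ω)ᵈ × H¹(Ω)` solves Darcy's equation on `Ω` with permeability `K`, source `f`,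
`p = 0` on `ΓD` and flux `K ∇p · ν = g` on `ΓF`: `p ∈ H¹_Dir(Ω)` satisfies
`∫_Ω K ∇p · ∇q - ∫_{ΓF} g q = ∫_Ω f q` for all `q ∈ H¹_Dir(Ω)`, and `v = -K ∇p`. -/
structure IsDarcySolution {d : ℕ} (Ω ΓD ΓF : Set (Euc d))
    (K : Euc d → Matrix (Fin d) (Fin d) ℝ) (f g : Euc d → ℝ)
    (v : Euc d → Euc d) (p : Euc d → ℝ) : Prop where
  pressure_mem : ∃ t, IsTraceVanishingOn Ω ΓD p t
  weak_form : ∀ q t : Euc d → ℝ, IsTraceVanishingOn Ω ΓD q t →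
    (∫ x in Ω, ⟪(K x).toEuclideanLin (weakGrad Ω p x), weakGrad Ω q x⟫_ℝ)
      - ∫ x in ΓF, g x * t x ∂(surfaceMeasure d) = ∫ x in Ω, f x * q x
  velocity_mem : MemLp v 2 (volume.restrict Ω)
  velocity_eq : ∀ᵐ x ∂(volume.restrict Ω), v x = -(K x).toEuclideanLin (weakGrad Ω p x)

end

/-!
The weak formulation is a coercive variational problem on `H¹_Dir(Ω)`, so a solution exists by the
Lax–Milgram theorem. If `p₁`, `p₂` solve the problem for `K₁`, `K₂`, then testing the difference of
the two equations with `p₂ - p₁` gives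
`lam ‖∇(p₂ - p₁)‖² ≤ ∫ (K₁ - K₂) ∇p₁ · ∇(p₂ - p₁)`, hence
`‖∇(p₂ - p₁)‖ ≤ ‖K₂ - K₁‖ ‖∇p₁‖ / lam`, and `‖∇p₁‖` is bounded by the data through the same
argument. Both steps rest on two facts: the right-hand side, which contains the boundary integral,
is continuous on `H¹_Dir(Ω)`, and `‖∇p‖` controls the `H¹`-norm there.

Both facts follow from one inequality for `C¹` functions `φ`. Let `m` be the sum of the Lebesgue
measure on `Ω` and the surface measure on `∂Ω` (`closureMeasure`). Then `m` is finite and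
`∫∫ |φ x - φ y|² dm dm ≤ C ∫_Ω |∇φ|²` (`IsBoundedLipschitzDomain.isPoincareLinked`). Restricting one
of the variables to the Dirichlet part `ΓD` bounds `∫ |φ|² dm` by `∫_ΓD |φ|²` and `∫_Ω |∇φ|²`. For
limits of smooth functions with vanishing trace on `ΓD` this is Friedrichs' inequality and the trace
inequality at once (`exists_norm_fst_le`).

The inequality is proved locally and chained. Near an interior point it is the Poincaré inequality
on a ball (`IsPoincareLinked.of_convex`). Near a boundary point, every point of the closed domain is
joined to a ball inside `Ω` by translations along the axis of the graph; translating the surface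
measure of a Lipschitz graph in this direction sweeps out a measure of bounded density
(`exists_lintegral_graph_translates_le`), so the fundamental theorem of calculus along the
translations suffices (`IsPoincareLinked.of_translates`). Two local inequalities can be combined if
the sets overlap in positive measure (`IsPoincareLinked.trans`), and `closure Ω` is compact and
connected. No compact embedding is needed.

For the functional analysis, an `H¹`-function on `Ω` and its trace on `∂Ω` are regarded as a single
element of `L²(m)`. Together with the gradient this gives a closed subspace of
`L²(m) × L²(Ω)ᵈ`, the closure of the pairs `(φ, ∇φ)` with `φ` smooth (`traceSpace`); it is
identified with the pairs in `IsTrace` by `isTrace_of_mem` and `IsTrace.exists_mem`.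
-/

/-! ### Mean square differences controlled by the Dirichlet energy -/

/-- Mean square differences between points distributed according to `μ` and points distributed
according to `ν` are controlled by the Dirichlet energy on `Ω`, uniformly for `C¹` functions. -/
def IsPoincareLinked {d : ℕ} (Ω : Set (Euc d)) (μ ν : Measure (Euc d)) : Prop :=
  ∃ C : ℝ≥0∞, C ≠ ⊤ ∧ ∀ φ : Euc d → ℝ, ContDiff ℝ 1 φ →
    ∫⁻ x, ∫⁻ y, ‖φ x - φ y‖ₑ ^ 2 ∂ν ∂μ ≤ C * ∫⁻ x in Ω, ‖fderiv ℝ φ x‖ₑ ^ 2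

lemma enorm_sub_sq_le_two_mul (a b c : ℝ) :
    ‖a - c‖ₑ ^ 2 ≤ 2 * (‖a - b‖ₑ ^ 2 + ‖b - c‖ₑ ^ 2) := by
  have h : ‖a - c‖₊ ^ 2 ≤ 2 * (‖a - b‖₊ ^ 2 + ‖b - c‖₊ ^ 2) := by
    have h1 : ‖a - c‖₊ ≤ ‖a - b‖₊ + ‖b - c‖₊ := by
      simpa using nnnorm_add_le (a - b) (b - c)
    calc ‖a - c‖₊ ^ 2 ≤ (‖a - b‖₊ + ‖b - c‖₊) ^ 2 := by gcongr
      _ ≤ _ := add_sq_le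
  simp only [enorm_eq_nnnorm]
  exact_mod_cast h

lemma sq_lintegral_le_measure_mul {α : Type*} [MeasurableSpace α] {μ : Measure α} {f : α → ℝ≥0∞}
    (hf : AEMeasurable f μ) : (∫⁻ x, f x ∂μ) ^ 2 ≤ μ Set.univ * ∫⁻ x, f x ^ 2 ∂μ := by
  have h := ENNReal.lintegral_mul_le_Lp_mul_Lq μ (Real.HolderConjugate.two_two)
    (f := fun _ => 1) (g := f) aemeasurable_const hf
  simp only [Pi.mul_apply, one_mul, ENNReal.one_rpow, lintegral_const] at h
  calc (∫⁻ x, f x ∂μ) ^ 2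
      ≤ (μ Set.univ ^ (1 / 2 : ℝ) * (∫⁻ x, f x ^ (2 : ℝ) ∂μ) ^ (1 / 2 : ℝ)) ^ 2 := by
        gcongr
    _ = _ := by
      rw [mul_pow, ← ENNReal.rpow_natCast, ← ENNReal.rpow_mul, ← ENNReal.rpow_natCast,
        ← ENNReal.rpow_mul]
      norm_num

/-- Cauchy–Schwarz for the fundamental theorem of calculus along the segment from `x` to
`x + t • v`. -/
lemma enorm_sub_sq_le_lintegral_segment {d : ℕ} {φ : Euc d → ℝ} (hφ : ContDiff ℝ 1 φ)
    (x v : Euc d) {t : ℝ} (ht : 0 ≤ t) :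
    ‖φ x - φ (x + t • v)‖ₑ ^ 2 ≤ ENNReal.ofReal t * ‖v‖ₑ ^ 2 *
      ∫⁻ s in Set.Ioo 0 t, ‖fderiv ℝ φ (x + s • v)‖ₑ ^ 2 := by
  have hd : Continuous (fderiv ℝ φ) := hφ.continuous_fderiv one_ne_zero
  have hc : Continuous fun s : ℝ => fderiv ℝ φ (x + s • v) := by fun_prop
  have hftc : ∫ s in (0 : ℝ)..t, fderiv ℝ φ (x + s • v) v = φ (x + t • v) - φ x := by
    have := intervalIntegral.integral_eq_sub_of_hasDerivAt (a := 0) (b := t)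
      (f := fun s : ℝ => φ (x + s • v)) (f' := fun s => fderiv ℝ φ (x + s • v) v) ?_ ?_
    · simpa using this
    · intro s _
      have h1 : HasDerivAt (fun s : ℝ => x + s • v) v s := by
        simpa using ((hasDerivAt_id s).smul_const v).const_add x
      exact ((hφ.differentiable one_ne_zero (x + s • v)).hasFDerivAt).comp_hasDerivAt s h1
    · exact Continuous.intervalIntegrable (by fun_prop) _ _
  rw [enorm_sub_rev, ← hftc, intervalIntegral.integral_of_le ht, integral_Ioc_eq_integral_Ioo]
  have hm : Measurable fun s : ℝ => ‖fderiv ℝ φ (x + s • v)‖ₑ := hc.enorm.measurable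
  calc ‖∫ s in Set.Ioo 0 t, fderiv ℝ φ (x + s • v) v‖ₑ ^ 2
      ≤ (∫⁻ s in Set.Ioo 0 t, ‖fderiv ℝ φ (x + s • v)‖ₑ * ‖v‖ₑ) ^ 2 := by
        gcongr
        refine (enorm_integral_le_lintegral_enorm _).trans (lintegral_mono fun s => ?_)
        exact ContinuousLinearMap.le_opENorm _ _
    _ = ‖v‖ₑ ^ 2 * (∫⁻ s in Set.Ioo 0 t, ‖fderiv ℝ φ (x + s • v)‖ₑ) ^ 2 := by
        rw [lintegral_mul_const _ hm]; ring
    _ ≤ ‖v‖ₑ ^ 2 * (ENNReal.ofReal t * ∫⁻ s in Set.Ioo 0 t, ‖fderiv ℝ φ (x + s • v)‖ₑ ^ 2) := by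
        gcongr
        simpa using sq_lintegral_le_measure_mul (μ := volume.restrict (Set.Ioo 0 t)) hm.aemeasurable
    _ = _ := by ring

lemma measurable_enorm_sub_sq {d : ℕ} {φ : Euc d → ℝ} (hφ : ContDiff ℝ 1 φ) :
    Measurable fun z : Euc d × Euc d => ‖φ z.1 - φ z.2‖ₑ ^ 2 := by
  have := hφ.continuous
  have h : Continuous fun z : Euc d × Euc d => ‖φ z.1 - φ z.2‖ₑ := by fun_prop
  exact h.measurable.pow_const 2

namespace IsPoincareLinked

variable {d : ℕ} {Ω : Set (Euc d)} {μ μ' ν ν' κ : Measure (Euc d)}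

lemma symm [SFinite μ] [SFinite ν] (h : IsPoincareLinked Ω μ ν) : IsPoincareLinked Ω ν μ := by
  obtain ⟨C, hC, h⟩ := h
  refine ⟨C, hC, fun φ hφ => ?_⟩
  rw [lintegral_lintegral_swap (measurable_enorm_sub_sq hφ).aemeasurable]
  simpa only [enorm_sub_rev] using h φ hφ

lemma mono (hμ : μ' ≤ μ) (hν : ν' ≤ ν) (h : IsPoincareLinked Ω μ ν) :
    IsPoincareLinked Ω μ' ν' := by
  obtain ⟨C, hC, h⟩ := h
  refine ⟨C, hC, fun φ hφ => le_trans ?_ (h φ hφ)⟩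
  exact (lintegral_mono fun x => lintegral_mono' hν le_rfl).trans (lintegral_mono' hμ le_rfl)

lemma zero_left : IsPoincareLinked Ω 0 ν := ⟨0, by simp, by simp⟩

lemma add_left (h : IsPoincareLinked Ω μ ν) (h' : IsPoincareLinked Ω μ' ν) :
    IsPoincareLinked Ω (μ + μ') ν := by
  obtain ⟨C, hC, h⟩ := h
  obtain ⟨C', hC', h'⟩ := h'
  refine ⟨C + C', by simp [hC, hC'], fun φ hφ => ?_⟩
  rw [lintegral_add_measure, add_mul]
  exact add_le_add (h φ hφ) (h' φ hφ)

lemma sum_left {ι : Type*} (s : Finset ι) (μ : ι → Measure (Euc d))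
    (h : ∀ i ∈ s, IsPoincareLinked Ω (μ i) ν) : IsPoincareLinked Ω (∑ i ∈ s, μ i) ν := by
  classical
  induction s using Finset.induction_on with
  | empty => simpa using zero_left
  | insert i s hi ih =>
    rw [Finset.sum_insert hi]
    exact (h i (by simp)).add_left (ih fun j hj => h j (by simp [hj]))

/-- Inserting an intermediate point distributed according to `ν` between two points distributed
according to `μ` and `κ`. -/
lemma lintegral_enorm_sub_sq_mul_le [SFinite ν] {φ : Euc d → ℝ} (hφ : ContDiff ℝ 1 φ)
    (hν : ν Set.univ ≠ ⊤) :
    (∫⁻ x, ∫⁻ z, ‖φ x - φ z‖ₑ ^ 2 ∂κ ∂μ) * ν Set.univ ≤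
      2 * (κ Set.univ * (∫⁻ x, ∫⁻ y, ‖φ x - φ y‖ₑ ^ 2 ∂ν ∂μ) +
        μ Set.univ * ∫⁻ z, ∫⁻ y, ‖φ z - φ y‖ₑ ^ 2 ∂ν ∂κ) := by
  have hm := measurable_enorm_sub_sq hφ
  have hm1 : ∀ x, Measurable fun y => ‖φ x - φ y‖ₑ ^ 2 := fun x =>
    hm.comp (measurable_const.prodMk measurable_id)
  obtain ⟨A, hA⟩ : ∃ A : Euc d → ℝ≥0∞, ∀ x, ∫⁻ y, ‖φ x - φ y‖ₑ ^ 2 ∂ν = A x :=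
    ⟨_, fun _ => rfl⟩
  have hAm : Measurable A := by
    have : Measurable fun x => ∫⁻ y, ‖φ x - φ y‖ₑ ^ 2 ∂ν := hm.lintegral_prod_right'
    simpa only [hA] using this
  have hp : ∀ x z, ‖φ x - φ z‖ₑ ^ 2 * ν Set.univ ≤ 2 * (A x + A z) := by
    intro x z
    rw [← lintegral_const, ← hA, ← hA, ← lintegral_add_left (hm1 x),
      ← lintegral_const_mul' _ _ (by simp)]
    refine lintegral_mono fun y => ?_
    rw [enorm_sub_rev (φ z)]
    exact enorm_sub_sq_le_two_mul _ _ _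
  simp only [hA]
  rw [← lintegral_mul_const' _ _ hν]
  calc ∫⁻ x, (∫⁻ z, ‖φ x - φ z‖ₑ ^ 2 ∂κ) * ν Set.univ ∂μ
      ≤ ∫⁻ x, ∫⁻ z, 2 * (A x + A z) ∂κ ∂μ := by
        refine lintegral_mono fun x => ?_
        rw [← lintegral_mul_const' _ _ hν]
        exact lintegral_mono fun z => hp x z
    _ = ∫⁻ x, 2 * (κ Set.univ * A x + ∫⁻ z, A z ∂κ) ∂μ := by
        refine lintegral_congr fun x => ?_
        rw [lintegral_const_mul' _ _ (by simp), lintegral_add_left measurable_const,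
          lintegral_const, mul_comm (A x)]
    _ = _ := by
        rw [lintegral_const_mul' _ _ (by simp), lintegral_add_right _ measurable_const,
          lintegral_const, lintegral_const_mul _ hAm, mul_comm (μ Set.univ)]

/-- Two controls can be chained through any non-zero measure. -/
lemma trans [IsFiniteMeasure μ] [IsFiniteMeasure ν] [IsFiniteMeasure κ] (hν : ν ≠ 0)
    (h : IsPoincareLinked Ω μ ν) (h' : IsPoincareLinked Ω ν κ) : IsPoincareLinked Ω μ κ := by
  obtain ⟨C, hC, h⟩ := h
  obtain ⟨C', hC', h'⟩ := h'.symm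
  have hν0 : ν Set.univ ≠ 0 := by simpa using hν
  have hνt : ν Set.univ ≠ ⊤ := measure_ne_top _ _
  refine ⟨2 * (κ Set.univ * C + μ Set.univ * C') / ν Set.univ, ?_, fun φ hφ => ?_⟩
  · exact ENNReal.div_ne_top (by finiteness) hν0
  rw [div_eq_mul_inv, mul_right_comm, ← div_eq_mul_inv, ENNReal.le_div_iff_mul_le (.inl hν0)
    (.inl hνt)]
  calc _ ≤ 2 * (κ Set.univ * (C * ∫⁻ x in Ω, ‖fderiv ℝ φ x‖ₑ ^ 2) +
      μ Set.univ * (C' * ∫⁻ x in Ω, ‖fderiv ℝ φ x‖ₑ ^ 2)) := by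
        refine (lintegral_enorm_sub_sq_mul_le hφ hνt).trans ?_
        gcongr
        · exact h φ hφ
        · exact h' φ hφ
    _ = _ := by ring

end IsPoincareLinked

/-! ### Convex sets and translates -/

lemma lintegral_comp_add_smul_le {d : ℕ} {F : Euc d → ℝ≥0∞} (hF : Measurable F) (c : Euc d)
    {s : ℝ} (hs : 1 / 2 ≤ s) : ∫⁻ z, F (c + s • z) ≤ 2 ^ d * ∫⁻ z, F z := by
  have hs0 : 0 < s := by linarith
  have h1 : ∫⁻ z, F (c + s • z) = ∫⁻ z, F (c + z) ∂(Measure.map (s • ·) volume) := by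
    rw [lintegral_map (by fun_prop) (by fun_prop)]
  rw [h1, Measure.map_addHaar_smul _ hs0.ne', lintegral_smul_measure,
    lintegral_add_left_eq_self F c, smul_eq_mul]
  gcongr
  rw [finrank_euclideanSpace, Fintype.card_fin, abs_of_pos (by positivity),
    show (2 : ℝ≥0∞) ^ d = ENNReal.ofReal (2 ^ d) by simp [ENNReal.ofReal_pow]]
  apply ENNReal.ofReal_le_ofReal
  rw [← inv_pow]
  gcongr
  rw [inv_le_comm₀ hs0 two_pos]
  simpa using hs

/-- Averages over a convex set of a function along the segments joining two points of the set: for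
each parameter `s`, one of the two end points can be used as integration variable. -/
lemma lintegral_segment_le_of_convex {d : ℕ} {Q : Set (Euc d)} (hQ : Convex ℝ Q)
    (hQm : MeasurableSet Q) {G : Euc d → ℝ≥0∞} (hG : Measurable G) {s : ℝ} (hs0 : 0 ≤ s)
    (hs1 : s ≤ 1) :
    ∫⁻ x in Q, ∫⁻ z in Q, G (x + s • (z - x)) ≤ 2 ^ d * volume Q * ∫⁻ x in Q, G x := by
  have key : ∀ t : ℝ, 1 / 2 ≤ t → t ≤ 1 → ∀ x ∈ Q,
      ∫⁻ z in Q, G ((1 - t) • x + t • z) ≤ 2 ^ d * ∫⁻ x in Q, G x := by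
    intro t ht ht1 x hx
    rw [← lintegral_indicator hQm, ← lintegral_indicator hQm]
    refine le_trans (lintegral_mono fun z => ?_)
      (lintegral_comp_add_smul_le (hG.indicator hQm) ((1 - t) • x) ht)
    by_cases hz : z ∈ Q
    · have : (1 - t) • x + t • z ∈ Q := hQ hx hz (by linarith) (by linarith) (by ring)
      simp [hz, this]
    · simp [hz]
  have hfin : ∀ f : Euc d → ℝ≥0∞, (∀ x ∈ Q, f x ≤ 2 ^ d * ∫⁻ x in Q, G x) →
      ∫⁻ x in Q, f x ≤ 2 ^ d * volume Q * ∫⁻ x in Q, G x := by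
    intro f hf
    calc ∫⁻ x in Q, f x ≤ ∫⁻ x in Q, 2 ^ d * ∫⁻ x in Q, G x := setLIntegral_mono' hQm hf
      _ = _ := by rw [setLIntegral_const]; ring
  rcases le_total (1 / 2) s with h | h
  · refine hfin _ fun x hx => ?_
    simpa only [show ∀ z : Euc d, x + s • (z - x) = (1 - s) • x + s • z from
      fun z => by module] using key s h hs1 x hx
  · rw [lintegral_lintegral_swap]
    · refine hfin _ fun z hz => ?_
      simpa only [show ∀ x : Euc d, x + s • (z - x) = (1 - (1 - s)) • z + (1 - s) • x from
        fun x => by module] using key (1 - s) (by linarith) (by linarith) z hz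
    · exact (hG.comp (by fun_prop)).aemeasurable

lemma measurable_enorm_fderiv_sq {d : ℕ} {φ : Euc d → ℝ} (hφ : ContDiff ℝ 1 φ) :
    Measurable fun x => ‖fderiv ℝ φ x‖ₑ ^ 2 :=
  (hφ.continuous_fderiv one_ne_zero).enorm.measurable.pow_const 2

namespace IsPoincareLinked

variable {d : ℕ} {Ω : Set (Euc d)} {μ : Measure (Euc d)}

/-- The Poincaré inequality on a bounded convex set. -/
lemma of_convex {Q : Set (Euc d)} (hQ : Convex ℝ Q) (hQm : MeasurableSet Q)
    (hQb : Bornology.IsBounded Q) (hQΩ : Q ⊆ Ω) :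
    IsPoincareLinked Ω (volume.restrict Q) (volume.restrict Q) := by
  refine ⟨Metric.ediam Q ^ 2 * (2 ^ d * volume Q), ?_, fun φ hφ => ?_⟩
  · have := hQb.measure_lt_top (μ := volume)
    have := hQb.ediam_ne_top
    finiteness
  have hG := measurable_enorm_fderiv_sq hφ
  set G : Euc d → ℝ≥0∞ := fun x => ‖fderiv ℝ φ x‖ₑ ^ 2
  calc ∫⁻ x in Q, ∫⁻ z in Q, ‖φ x - φ z‖ₑ ^ 2
      ≤ ∫⁻ x in Q, ∫⁻ z in Q, Metric.ediam Q ^ 2 * ∫⁻ s in Set.Ioo (0 : ℝ) 1,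
          G (x + s • (z - x)) := by
        refine setLIntegral_mono' hQm fun x hx => setLIntegral_mono' hQm fun z hz => ?_
        have h := enorm_sub_sq_le_lintegral_segment hφ x (z - x) zero_le_one
        rw [one_smul, add_sub_cancel, ENNReal.ofReal_one, one_mul] at h
        refine h.trans ?_
        gcongr
        rw [← edist_eq_enorm_sub]
        exact Metric.edist_le_ediam_of_mem hz hx
    _ = Metric.ediam Q ^ 2 * ∫⁻ x in Q, ∫⁻ z in Q, ∫⁻ s in Set.Ioo (0 : ℝ) 1,
          G (x + s • (z - x)) := by
        have := hQb.ediam_ne_top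
        rw [← lintegral_const_mul' _ _ (by finiteness)]
        refine lintegral_congr fun x => ?_
        rw [← lintegral_const_mul' _ _ (by finiteness)]
    _ = Metric.ediam Q ^ 2 * ∫⁻ s in Set.Ioo (0 : ℝ) 1, ∫⁻ x in Q, ∫⁻ z in Q,
          G (x + s • (z - x)) := by
        congr 1
        calc _ = ∫⁻ x in Q, ∫⁻ s in Set.Ioo (0 : ℝ) 1, ∫⁻ z in Q, G (x + s • (z - x)) := by
              refine lintegral_congr fun x => lintegral_lintegral_swap ?_
              exact (hG.comp (by fun_prop)).aemeasurable
          _ = _ := by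
              refine lintegral_lintegral_swap (Measurable.aemeasurable ?_)
              refine Measurable.lintegral_prod_right' (f := fun w : (Euc d × ℝ) × Euc d =>
                G (w.1.1 + w.1.2 • (w.2 - w.1.1))) ?_
              exact hG.comp (by fun_prop)
    _ ≤ Metric.ediam Q ^ 2 * ∫⁻ s in Set.Ioo (0 : ℝ) 1, 2 ^ d * volume Q * ∫⁻ x in Q, G x := by
        refine mul_le_mul_right ?_ _
        exact setLIntegral_mono' measurableSet_Ioo fun s hs =>
          lintegral_segment_le_of_convex hQ hQm hG hs.1.le hs.2.le
    _ = Metric.ediam Q ^ 2 * (2 ^ d * volume Q) * ∫⁻ x in Q, G x := by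
        simp [mul_assoc]
    _ ≤ _ := by gcongr

/-- If translating `μ` by `s • e`, `0 < s < T`, sweeps out an absolutely continuous measure of
bounded density which lives on `Ω`, and on `Q` for `s` close to `T`, then `μ` is linked to the
Lebesgue measure on `Q`. -/
lemma of_translates [IsFiniteMeasure μ] (hΩ : MeasurableSet Ω) {Q : Set (Euc d)}
    (hQm : MeasurableSet Q) (hQf : volume Q ≠ ⊤)
    (hQ : IsPoincareLinked Ω (volume.restrict Q) (volume.restrict Q))
    {e : Euc d} {a T : ℝ} (ha : 0 ≤ a) (haT : a < T) {C : ℝ≥0∞} (hC : C ≠ ⊤)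
    (hμ : ∀ F : Euc d → ℝ≥0∞, Measurable F →
      ∫⁻ x, (∫⁻ s in Set.Ioo 0 T, F (x + s • e)) ∂μ ≤ C * ∫⁻ x, F x)
    (hμΩ : ∀ᵐ x ∂μ, ∀ s ∈ Set.Ioo 0 T, x + s • e ∈ Ω)
    (hμQ : ∀ᵐ x ∂μ, ∀ s ∈ Set.Ioo a T, x + s • e ∈ Q) :
    IsPoincareLinked Ω μ (volume.restrict Q) := by
  obtain ⟨CQ, hCQ, hQ⟩ := hQ
  set τ : ℝ≥0∞ := ENNReal.ofReal (T - a)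
  have hτ : τ ≠ 0 := by simpa [τ] using haT
  have hτt : τ ≠ ⊤ := by simp [τ]
  have hvol : volume (Set.Ioo a T) = τ := Real.volume_Ioo
  refine ⟨2 * (volume Q * τ * (ENNReal.ofReal T * ‖e‖ₑ ^ 2) * C + C * CQ) / τ, ?_, fun φ hφ => ?_⟩
  · exact ENNReal.div_ne_top (by finiteness) hτ
  rw [div_eq_mul_inv, mul_right_comm, ← div_eq_mul_inv, ENNReal.le_div_iff_mul_le (.inl hτ)
    (.inl hτt)]
  have hm := measurable_enorm_sub_sq hφ
  have hG := measurable_enorm_fderiv_sq hφ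
  obtain ⟨A, hA⟩ : ∃ A : Euc d → ℝ≥0∞, ∀ x, ∫⁻ y in Q, ‖φ x - φ y‖ₑ ^ 2 = A x :=
    ⟨_, fun _ => rfl⟩
  have hAm : Measurable A := by
    have : Measurable fun x => ∫⁻ y in Q, ‖φ x - φ y‖ₑ ^ 2 := hm.lintegral_prod_right'
    simpa only [hA] using this
  have hQφ := hQ φ hφ
  simp only [hA] at hQφ ⊢
  set G : Euc d → ℝ≥0∞ := fun x => ‖fderiv ℝ φ x‖ₑ ^ 2
  -- The energy along the segments starting on `μ`.
  have h1 : ∫⁻ x, (∫⁻ s in Set.Ioo 0 T, G (x + s • e)) ∂μ ≤ C * ∫⁻ x in Ω, G x := by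
    rw [← lintegral_indicator hΩ]
    refine le_trans (le_of_eq (lintegral_congr_ae ?_)) (hμ _ (hG.indicator hΩ))
    filter_upwards [hμΩ] with x hx
    refine setLIntegral_congr_fun measurableSet_Ioo fun s hs => ?_
    simp [hx s hs]
  -- The deviation from `Q` of the translated points.
  have h2 : ∫⁻ x, (∫⁻ s in Set.Ioo a T, A (x + s • e)) ∂μ ≤ C * ∫⁻ x in Q, A x := by
    rw [← lintegral_indicator hQm]
    refine le_trans (lintegral_mono_ae ?_) (hμ _ (hAm.indicator hQm))
    filter_upwards [hμQ] with x hx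
    calc ∫⁻ s in Set.Ioo a T, A (x + s • e)
        = ∫⁻ s in Set.Ioo a T, Q.indicator A (x + s • e) :=
          setLIntegral_congr_fun measurableSet_Ioo fun s hs => by simp [hx s hs]
      _ ≤ _ := lintegral_mono_set (Set.Ioo_subset_Ioo_left ha)
  have h3 : ∀ x, ∀ s ∈ Set.Ioo a T, A x ≤ 2 * (volume Q * (ENNReal.ofReal T * ‖e‖ₑ ^ 2 *
      ∫⁻ r in Set.Ioo 0 T, G (x + r • e)) + A (x + s • e)) := by
    intro x s hs
    have hs0 : 0 ≤ s := ha.trans hs.1.le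
    calc A x ≤ ∫⁻ y in Q, 2 * (‖φ x - φ (x + s • e)‖ₑ ^ 2 + ‖φ (x + s • e) - φ y‖ₑ ^ 2) := by
          rw [← hA]
          exact lintegral_mono fun y => enorm_sub_sq_le_two_mul _ _ _
      _ = 2 * (volume Q * ‖φ x - φ (x + s • e)‖ₑ ^ 2 + A (x + s • e)) := by
          rw [lintegral_const_mul' _ _ (by simp), lintegral_add_left measurable_const,
            setLIntegral_const, hA, mul_comm (volume Q)]
      _ ≤ _ := by
          gcongr
          refine (enorm_sub_sq_le_lintegral_segment hφ x e hs0).trans ?_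
          gcongr
          · exact hs.2.le
          · exact hs.2.le
  have hAe : Measurable fun w : Euc d × ℝ => A (w.1 + w.2 • e) := hAm.comp (by fun_prop)
  have hGe : Measurable fun x => ∫⁻ r in Set.Ioo 0 T, G (x + r • e) :=
    Measurable.lintegral_prod_right' (f := fun w : Euc d × ℝ => G (w.1 + w.2 • e))
      (hG.comp (by fun_prop))
  have hAe' : Measurable fun x => ∫⁻ s in Set.Ioo a T, A (x + s • e) := hAe.lintegral_prod_right'
  calc (∫⁻ x, A x ∂μ) * τ = ∫⁻ x, (∫⁻ s in Set.Ioo a T, A x) ∂μ := by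
        simp only [setLIntegral_const, hvol]
        rw [lintegral_mul_const' _ _ hτt]
    _ ≤ ∫⁻ x, (∫⁻ s in Set.Ioo a T, 2 * (volume Q * (ENNReal.ofReal T * ‖e‖ₑ ^ 2 *
          ∫⁻ r in Set.Ioo 0 T, G (x + r • e)) + A (x + s • e))) ∂μ :=
        lintegral_mono fun x => setLIntegral_mono' measurableSet_Ioo (h3 x)
    _ = ∫⁻ x, 2 * (volume Q * (ENNReal.ofReal T * ‖e‖ₑ ^ 2 * (∫⁻ r in Set.Ioo 0 T,
          G (x + r • e))) * τ + ∫⁻ s in Set.Ioo a T, A (x + s • e)) ∂μ := by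
        refine lintegral_congr fun x => ?_
        rw [lintegral_const_mul' _ _ (by simp), lintegral_add_left measurable_const,
          setLIntegral_const, hvol]
    _ = 2 * (volume Q * (ENNReal.ofReal T * ‖e‖ₑ ^ 2 * ∫⁻ x, (∫⁻ r in Set.Ioo 0 T,
          G (x + r • e)) ∂μ) * τ + ∫⁻ x, (∫⁻ s in Set.Ioo a T, A (x + s • e)) ∂μ) := by
        rw [lintegral_const_mul' _ _ (by simp), lintegral_add_right _ hAe',
          lintegral_mul_const' _ _ hτt, lintegral_const_mul' _ _ hQf,
          lintegral_const_mul' _ _ (by finiteness)]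
    _ ≤ 2 * (volume Q * (ENNReal.ofReal T * ‖e‖ₑ ^ 2 * (C * ∫⁻ x in Ω, G x)) * τ +
          C * (CQ * ∫⁻ x in Ω, G x)) := by
        gcongr
        exact h2.trans (by gcongr)
    _ = _ := by ring

end IsPoincareLinked

/-! ### Surface measure on Lipschitz graphs -/

lemma LipschitzWith.euclideanHausdorffMeasure_image_le {X Y : Type*} [EMetricSpace X]
    [MeasurableSpace X] [BorelSpace X] [EMetricSpace Y] [MeasurableSpace Y] [BorelSpace Y]
    {K : ℝ≥0} {f : X → Y} (hf : LipschitzWith K f) (n : ℕ) (s : Set X) :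
    (μHE[n] : Measure Y) (f '' s) ≤ (K : ℝ≥0∞) ^ n * (μHE[n] : Measure X) s := by
  have h := hf.hausdorffMeasure_image_le (d := n) (by positivity) s
  rw [ENNReal.rpow_natCast] at h
  simp only [Measure.euclideanHausdorffMeasure_def, Measure.smul_apply, ENNReal.smul_def,
    smul_eq_mul]
  rw [mul_left_comm]
  gcongr

section Graph

variable {d : ℕ} {e : Euc d}

lemma lintegral_orthogonal_add_smul (he : ‖e‖ = 1) {F : Euc d → ℝ≥0∞} (hF : Measurable F) :
    ∫⁻ y : (ℝ ∙ e)ᗮ, ∫⁻ s : ℝ, F (y + s • e) = ∫⁻ x, F x := by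
  have h1 := (Submodule.measurePreserving_measurableEquivProd (ℝ ∙ e) (0 : Euc d)).symm
  rw [InnerProductSpace.euclideanHausdorffMeasure_eq_volume] at h1
  have h2 : MeasurePreserving (LinearIsometryEquiv.toSpanUnitSingleton (𝕜 := ℝ) e he)
    volume volume := LinearIsometryEquiv.measurePreserving _
  rw [← h1.lintegral_comp hF, Measure.volume_eq_prod, lintegral_prod_symm]
  · refine lintegral_congr fun y => ?_
    rw [← h2.lintegral_comp]
    · refine lintegral_congr fun s => ?_
      simp [add_comm]
    · exact hF.comp (h1.measurable.comp (by fun_prop))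
  · exact (hF.comp h1.measurable).aemeasurable

/-- The surface measure on a Lipschitz graph is at most a constant times the image of the Lebesgue
measure of the base hyperplane, so that sweeping it in the direction orthogonal to the base gives a
measure of bounded density. -/
lemma exists_lintegral_graph_translates_le (he : ‖e‖ = 1) {L : ℝ≥0} {γ : (ℝ ∙ e)ᗮ → ℝ}
    (hγ : LipschitzWith L γ) :
    ∃ C : ℝ≥0∞, C ≠ ⊤ ∧ ∀ F : Euc d → ℝ≥0∞, Measurable F →
      ∫⁻ x in {x | γ ((ℝ ∙ e)ᗮ.orthogonalProjectionOnto x) = ⟪e, x⟫_ℝ},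
        (∫⁻ s : ℝ, F (x + s • e)) ∂(surfaceMeasure d) ≤ C * ∫⁻ x, F x := by
  have he0 : e ≠ 0 := by rintro rfl; simp at he
  set g : (ℝ ∙ e)ᗮ → Euc d := fun y => y + γ y • e with hg
  have hgL : LipschitzWith (1 + L) g := by
    refine LipschitzWith.add (LipschitzWith.subtype_val _) ?_
    refine LipschitzWith.of_dist_le_mul fun y z => ?_
    rw [dist_eq_norm, ← sub_smul, norm_smul, he, mul_one, ← dist_eq_norm]
    exact hγ.dist_le_mul y z
  have hrank : Module.finrank ℝ (ℝ ∙ e)ᗮ = d - 1 := by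
    have h1 := (ℝ ∙ e).finrank_add_finrank_orthogonal
    rw [finrank_span_singleton he0, finrank_euclideanSpace, Fintype.card_fin] at h1
    omega
  set S : Set (Euc d) := {x | γ ((ℝ ∙ e)ᗮ.orthogonalProjectionOnto x) = ⟪e, x⟫_ℝ}
  have hle : (surfaceMeasure d).restrict S ≤
      ((1 + L : ℝ≥0) : ℝ≥0∞) ^ (d - 1) • Measure.map g volume := by
    refine Measure.le_iff.2 fun A hA => ?_
    rw [Measure.restrict_apply hA, Measure.smul_apply,
      Measure.map_apply hgL.continuous.measurable hA, smul_eq_mul]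
    have hsub : A ∩ S ⊆ g '' (g ⁻¹' A) := by
      rintro x ⟨hxA, hxS⟩
      have hx : g ((ℝ ∙ e)ᗮ.orthogonalProjectionOnto x) = x := by
        simp only [hg]
        rw [show γ ((ℝ ∙ e)ᗮ.orthogonalProjectionOnto x) = ⟪e, x⟫_ℝ from hxS]
        have h1 := (ℝ ∙ e).starProjection_add_starProjection_orthogonal x
        rw [Submodule.starProjection_unit_singleton ℝ he, add_comm] at h1
        exact h1
      exact ⟨_, by simpa [hx] using hxA, hx⟩
    refine (measure_mono hsub).trans ((hgL.euclideanHausdorffMeasure_image_le _ _).trans ?_)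
    rw [← InnerProductSpace.euclideanHausdorffMeasure_eq_volume, hrank]
  refine ⟨((1 + L : ℝ≥0) : ℝ≥0∞) ^ (d - 1), by finiteness, fun F hF => ?_⟩
  have hFm : Measurable fun x => ∫⁻ s : ℝ, F (x + s • e) :=
    Measurable.lintegral_prod_right' (f := fun w : Euc d × ℝ => F (w.1 + w.2 • e))
      (hF.comp (by fun_prop))
  refine (lintegral_mono' hle le_rfl).trans (le_of_eq ?_)
  rw [lintegral_smul_measure, lintegral_map hFm hgL.continuous.measurable, smul_eq_mul,
    ← lintegral_orthogonal_add_smul he hF]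
  congr 1
  refine lintegral_congr fun y => ?_
  rw [← lintegral_add_left_eq_self (fun s : ℝ => F (y + s • e)) (γ y)]
  simp only [hg, add_smul, add_assoc]

end Graph

/-! ### Poincaré's inequality on a Lipschitz domain and its boundary -/

/-- The sum of the Lebesgue measure on `Ω` and the surface measure on `∂Ω`. Functions in
`L²(closureMeasure Ω)` are pairs consisting of a function on `Ω` and a function on `∂Ω`. -/
noncomputable def closureMeasure {d : ℕ} (Ω : Set (Euc d)) : Measure (Euc d) :=
  volume.restrict Ω + (surfaceMeasure d).restrict (frontier Ω)

section Poincare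

variable {d : ℕ} {Ω : Set (Euc d)}

lemma ae_closureMeasure_mem_closure (hΩ : MeasurableSet Ω) :
    ∀ᵐ x ∂(closureMeasure Ω), x ∈ closure Ω := by
  rw [closureMeasure, ae_add_measure_iff]
  exact ⟨(ae_restrict_mem hΩ).mono fun x hx => subset_closure hx,
    (ae_restrict_mem isClosed_frontier.measurableSet).mono fun x hx => frontier_subset_closure hx⟩

/-- Interior points: near them the measure is the Lebesgue measure on a ball. -/
lemma exists_isPoincareLinked_nhds_of_mem (hΩ : IsOpen Ω) {x₀ : Euc d} (hx₀ : x₀ ∈ Ω) :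
    ∃ U : Set (Euc d), IsOpen U ∧ x₀ ∈ U ∧ closureMeasure Ω U ≠ ⊤ ∧
      IsPoincareLinked Ω ((closureMeasure Ω).restrict U) ((closureMeasure Ω).restrict U) := by
  obtain ⟨r, hr, hrΩ⟩ := Metric.isOpen_iff.1 hΩ x₀ hx₀
  have h : (closureMeasure Ω).restrict (Metric.ball x₀ r) =
      volume.restrict (Metric.ball x₀ r) := by
    rw [closureMeasure, Measure.restrict_add, Measure.restrict_restrict measurableSet_ball,
      Measure.restrict_restrict measurableSet_ball, Set.inter_eq_left.2 hrΩ]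
    have : Metric.ball x₀ r ∩ frontier Ω = ∅ :=
      Set.subset_eq_empty (Set.inter_subset_inter_left _ hrΩ) hΩ.inter_frontier_eq
    simp [this]
  refine ⟨Metric.ball x₀ r, Metric.isOpen_ball, Metric.mem_ball_self hr, ?_, ?_⟩
  · rw [← Measure.restrict_apply_univ, h, Measure.restrict_apply_univ]
    exact measure_ball_lt_top.ne
  · rw [h]
    exact .of_convex (convex_ball _ _) measurableSet_ball Metric.isBounded_ball hrΩ

/-- Boundary points: near them, vertical translations move the closed domain into a ball contained
in the domain. -/
lemma exists_isPoincareLinked_nhds_of_mem_frontier (hΩ : IsOpen Ω)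
    (hL : HasLipschitzBoundary Ω) {x₀ : Euc d} (hx₀ : x₀ ∈ frontier Ω) :
    ∃ U : Set (Euc d), IsOpen U ∧ x₀ ∈ U ∧ closureMeasure Ω U ≠ ⊤ ∧
      IsPoincareLinked Ω ((closureMeasure Ω).restrict U) ((closureMeasure Ω).restrict U) := by
  obtain ⟨e, he, r, hr, L, γ, hγ, hΩr⟩ := hL x₀ hx₀
  -- The height above the graph.
  set p : Euc d → ℝ := fun x => ⟪e, x⟫_ℝ - γ ((ℝ ∙ e)ᗮ.orthogonalProjectionOnto x) with hp
  have hΩp : ∀ x ∈ Metric.ball x₀ r, (x ∈ Ω ↔ 0 < p x) := fun x hx => by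
    rw [hΩr x hx, hp, sub_pos]
  have hpL : LipschitzWith (1 + L) p := by
    refine LipschitzWith.sub ?_ ?_
    · refine LipschitzWith.of_dist_le_mul fun x y => ?_
      rw [Real.dist_eq, ← inner_sub_right, dist_eq_norm]
      simpa [he] using abs_real_inner_le_norm e (x - y)
    · have h := hγ.comp (ℝ ∙ e)ᗮ.lipschitzWith_orthogonalProjectionOnto
      rwa [mul_one] at h
  have hpadd : ∀ x (s : ℝ), p (x + s • e) = p x + s := by
    intro x s
    have h1 : (ℝ ∙ e)ᗮ.orthogonalProjectionOnto e = 0 := by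
      rw [Submodule.orthogonalProjectionOnto_eq_zero_iff, Submodule.orthogonal_orthogonal]
      exact Submodule.mem_span_singleton_self e
    simp only [hp, map_add, map_smul, h1, smul_zero, add_zero, inner_add_right, inner_smul_right,
      real_inner_self_eq_norm_sq, he]
    ring
  have hpc : ∀ x ∈ Metric.ball x₀ r, x ∈ closure Ω → 0 ≤ p x := by
    intro x hx hxΩ
    by_contra! hneg
    have ho : IsOpen (Metric.ball x₀ r ∩ {x | p x < 0}) :=
      Metric.isOpen_ball.inter (isOpen_lt hpL.continuous continuous_const)
    obtain ⟨y, hy, hyΩ⟩ := mem_closure_iff.1 hxΩ _ ho ⟨hx, hneg⟩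
    exact lt_asymm hy.2 ((hΩp y hy.1).1 hyΩ)
  have hpf : ∀ x ∈ Metric.ball x₀ r, x ∈ frontier Ω → p x = 0 := by
    intro x hx hxΩ
    rw [hΩ.frontier_eq] at hxΩ
    refine le_antisymm ?_ (hpc x hx hxΩ.1)
    by_contra! hpos
    exact hxΩ.2 ((hΩp x hx).2 hpos)
  have hL1 : (1 : ℝ) ≤ 1 + L := by simp
  obtain ⟨δ, hδ, hδr⟩ : ∃ δ : ℝ, 0 < δ ∧ (1 + L) * (8 * δ) = r :=
    ⟨r / (8 * (1 + L)), by positivity, by field_simp⟩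
  have hδ8 : 8 * δ ≤ r := by nlinarith
  set h : ℝ := r / 2 with hh
  set T : ℝ := h + δ with hT
  set Q : Set (Euc d) := Metric.ball (x₀ + h • e) (2 * δ) with hQ
  set U : Set (Euc d) := Metric.ball x₀ δ with hU
  have hx₀r : x₀ ∈ Metric.ball x₀ r := Metric.mem_ball_self hr
  have hUr : U ⊆ Metric.ball x₀ r := Metric.ball_subset_ball (by linarith)
  have hQΩ : Q ⊆ Ω := by
    intro z hz
    rw [hQ, Metric.mem_ball] at hz
    have hzr : z ∈ Metric.ball x₀ r := by
      rw [Metric.mem_ball]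
      refine (dist_triangle z (x₀ + h • e) x₀).trans_lt ?_
      rw [dist_self_add_left, norm_smul, he, Real.norm_of_nonneg (by positivity)]
      linarith
    rw [hΩp z hzr]
    have h1 := hpL.dist_le_mul z (x₀ + h • e)
    rw [hpadd, hpf x₀ hx₀r hx₀, zero_add, Real.dist_eq] at h1
    push_cast at h1
    have h2 := (abs_le.1 h1).1
    nlinarith
  have hmove : ∀ x ∈ U, ∀ s ∈ Set.Ioo 0 T, x + s • e ∈ Metric.ball x₀ r := by
    intro x hx s hs
    rw [hU, Metric.mem_ball] at hx
    rw [Metric.mem_ball]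
    refine (dist_triangle _ x x₀).trans_lt ?_
    rw [dist_self_add_left, norm_smul, he, Real.norm_of_nonneg hs.1.le]
    linarith [hs.2]
  set μ := (closureMeasure Ω).restrict U with hμ
  have hμU : ∀ᵐ x ∂μ, x ∈ U := ae_restrict_mem measurableSet_ball
  have hμc : ∀ᵐ x ∂μ, x ∈ closure Ω :=
    ae_restrict_of_ae (ae_closureMeasure_mem_closure hΩ.measurableSet)
  -- Vertical translations of `μ` sweep out a measure of bounded density.
  obtain ⟨C, hC, hsweep⟩ : ∃ C : ℝ≥0∞, C ≠ ⊤ ∧ ∀ F : Euc d → ℝ≥0∞, Measurable F →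
      ∫⁻ x, (∫⁻ s in Set.Ioo 0 T, F (x + s • e)) ∂μ ≤ C * ∫⁻ x, F x := by
    obtain ⟨C, hC, hC'⟩ := exists_lintegral_graph_translates_le he hγ
    refine ⟨ENNReal.ofReal T + C, by finiteness, fun F hF => ?_⟩
    rw [hμ, closureMeasure, Measure.restrict_add, lintegral_add_measure, add_mul]
    gcongr
    · calc _ ≤ ∫⁻ x, ∫⁻ s in Set.Ioo 0 T, F (x + s • e) :=
            lintegral_mono' (Measure.restrict_le_self.trans Measure.restrict_le_self) le_rfl
        _ = ∫⁻ s in Set.Ioo 0 T, ∫⁻ x, F (x + s • e) :=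
            lintegral_lintegral_swap (hF.comp (by fun_prop)).aemeasurable
        _ = _ := by
            simp_rw [lintegral_add_right_eq_self F]
            simp [mul_comm]
    · refine le_trans ?_ (hC' F hF)
      rw [Measure.restrict_restrict measurableSet_ball]
      refine lintegral_mono' (Measure.restrict_mono ?_ le_rfl)
        fun x => setLIntegral_le_lintegral _ _
      rintro x ⟨hxU, hxf⟩
      exact (sub_eq_zero.1 (hpf x (hUr hxU) hxf)).symm
  have hT0 : 0 < T := by positivity
  have hfin : μ Set.univ ≠ ⊤ := by
    have h1 := hsweep ((Metric.ball x₀ r).indicator 1)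
      (measurable_one.indicator measurableSet_ball)
    rw [lintegral_indicator_one measurableSet_ball] at h1
    have h2 : ENNReal.ofReal T * μ Set.univ ≤ C * volume (Metric.ball x₀ r) := by
      refine le_trans (le_of_eq ?_) h1
      rw [← lintegral_const]
      refine lintegral_congr_ae ?_
      filter_upwards [hμU] with x hx
      rw [setLIntegral_congr_fun (g := fun _ => 1) measurableSet_Ioo fun s hs => by
        simp [Set.indicator_of_mem (hmove x hx s hs)]]
      simp
    intro htop
    rw [htop, ENNReal.mul_top (by simpa using hT0), top_le_iff] at h2
    exact ENNReal.mul_ne_top hC measure_ball_lt_top.ne h2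
  have : IsFiniteMeasure μ := ⟨hfin.lt_top⟩
  have hQfin : IsFiniteMeasure (volume.restrict Q) :=
    ⟨by rw [Measure.restrict_apply_univ]; exact measure_ball_lt_top⟩
  have hlink : IsPoincareLinked Ω μ (volume.restrict Q) := by
    refine .of_translates hΩ.measurableSet measurableSet_ball measure_ball_lt_top.ne
      (.of_convex (convex_ball _ _) measurableSet_ball Metric.isBounded_ball hQΩ)
      (e := e) (a := h - δ) (T := T) (by linarith) (by linarith) hC hsweep ?_ ?_
    · filter_upwards [hμU, hμc] with x hxU hxc s hs
      rw [hΩp _ (hmove x hxU s hs), hpadd]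
      linarith [hpc x (hUr hxU) hxc, hs.1]
    · filter_upwards [hμU] with x hxU s hs
      rw [hU, Metric.mem_ball, dist_eq_norm] at hxU
      rw [hQ, Metric.mem_ball, dist_eq_norm,
        show x + s • e - (x₀ + h • e) = (x - x₀) + (s - h) • e by module]
      refine (norm_add_le _ _).trans_lt ?_
      rw [norm_smul, he, mul_one, Real.norm_eq_abs]
      have : |s - h| < δ := abs_lt.2 ⟨by linarith [hs.1], by linarith [hs.2]⟩
      linarith
  refine ⟨U, Metric.isOpen_ball, Metric.mem_ball_self hδ, by simpa [hμ] using hfin, ?_⟩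
  refine hlink.trans ?_ hlink.symm
  rw [Ne, Measure.restrict_eq_zero]
  exact (Metric.measure_ball_pos _ _ (by positivity)).ne'

lemma IsBoundedLipschitzDomain.exists_nhds (hΩ : IsBoundedLipschitzDomain Ω) {x : Euc d}
    (hx : x ∈ closure Ω) :
    ∃ U : Set (Euc d), IsOpen U ∧ x ∈ U ∧ closureMeasure Ω U ≠ ⊤ ∧
      IsPoincareLinked Ω ((closureMeasure Ω).restrict U) ((closureMeasure Ω).restrict U) := by
  by_cases h : x ∈ Ω
  · exact exists_isPoincareLinked_nhds_of_mem hΩ.isOpen h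
  · refine exists_isPoincareLinked_nhds_of_mem_frontier hΩ.isOpen hΩ.lipschitz ?_
    rw [hΩ.isOpen.frontier_eq]
    exact ⟨hx, h⟩

lemma IsBoundedLipschitzDomain.isCompact_closure (hΩ : IsBoundedLipschitzDomain Ω) :
    IsCompact (closure Ω) := hΩ.isBounded.isCompact_closure

lemma IsBoundedLipschitzDomain.isFiniteMeasure (hΩ : IsBoundedLipschitzDomain Ω) :
    IsFiniteMeasure (closureMeasure Ω) := by
  have h : closureMeasure Ω (closure Ω) < ⊤ := by
    refine hΩ.isCompact_closure.measure_lt_top_of_nhdsWithin fun x hx => ?_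
    obtain ⟨U, hU, hxU, hfin, -⟩ := hΩ.exists_nhds hx
    exact ⟨U, mem_nhdsWithin_of_mem_nhds (hU.mem_nhds hxU), hfin.lt_top⟩
  refine ⟨?_⟩
  rwa [measure_congr (t := Set.univ)] at h
  exact eventuallyEq_univ.2 (ae_closureMeasure_mem_closure hΩ.isOpen.measurableSet)

/-- Poincaré's inequality including boundary values: the local controls chain along the connected
set `closure Ω`, and finitely many of them suffice by compactness. -/
theorem IsBoundedLipschitzDomain.isPoincareLinked (hΩ : IsBoundedLipschitzDomain Ω) :
    IsPoincareLinked Ω (closureMeasure Ω) (closureMeasure Ω) := by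
  have := hΩ.isFiniteMeasure
  choose! U hUo hxU _ hU using fun x hx => hΩ.exists_nhds (x := x) hx
  set m := closureMeasure Ω
  have hpos : ∀ V : Set (Euc d), IsOpen V → (V ∩ closure Ω).Nonempty → m.restrict V ≠ 0 := by
    rintro V hV ⟨y, hyV, hyΩ⟩
    have hne : (V ∩ Ω).Nonempty := mem_closure_iff.1 hyΩ V hV hyV
    rw [Ne, Measure.restrict_eq_zero]
    refine ne_of_gt (((hV.inter hΩ.isOpen).measure_pos volume hne).trans_le ?_)
    rw [← Measure.restrict_apply hV.measurableSet]
    exact le_self_add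
  have hpair : ∀ x ∈ closure Ω, ∀ y ∈ closure Ω,
      IsPoincareLinked Ω (m.restrict (U x)) (m.restrict (U y)) := by
    intro x hx y hy
    refine hΩ.isConnected.isPreconnected.closure.induction₂
      (fun x y => IsPoincareLinked Ω (m.restrict (U x)) (m.restrict (U y))) (fun x hx => ?_)
      (fun x y z _ hy _ hxy hyz => hxy.trans (hpos _ (hUo y hy) ⟨y, hxU y hy, hy⟩) hyz)
      (fun x y _ _ h => h.symm) hx hy
    filter_upwards [mem_nhdsWithin_of_mem_nhds ((hUo x hx).mem_nhds (hxU x hx)),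
      self_mem_nhdsWithin] with y hyU hy
    have hi := hpos (U x ∩ U y) ((hUo x hx).inter (hUo y hy)) ⟨y, ⟨hyU, hxU y hy⟩, hy⟩
    refine IsPoincareLinked.trans hi ((hU x hx).mono le_rfl ?_) ((hU y hy).mono ?_ le_rfl)
    · exact Measure.restrict_mono Set.inter_subset_left le_rfl
    · exact Measure.restrict_mono Set.inter_subset_right le_rfl
  obtain ⟨t, htΩ, ht⟩ := hΩ.isCompact_closure.elim_nhds_subcover U
    fun x hx => (hUo x hx).mem_nhds (hxU x hx)
  have hsum : IsPoincareLinked Ω (∑ x ∈ t, m.restrict (U x)) (∑ x ∈ t, m.restrict (U x)) := by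
    refine .sum_left _ _ fun x hx => IsPoincareLinked.symm (.sum_left _ _ fun y hy => ?_)
    exact hpair y (htΩ y hy) x (htΩ x hx)
  have hle : m ≤ ∑ x ∈ t, m.restrict (U x) := by
    refine Measure.le_iff.2 fun A hA => ?_
    have hcover : m A ≤ m (⋃ x ∈ t, A ∩ U x) := by
      refine measure_mono_ae ?_
      filter_upwards [ae_closureMeasure_mem_closure hΩ.isOpen.measurableSet] with x hx hxA
      obtain ⟨y, hy, hxy⟩ := Set.mem_iUnion₂.1 (ht hx)
      exact Set.mem_iUnion₂.2 ⟨y, hy, hxA, hxy⟩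
    refine hcover.trans ((measure_biUnion_finset_le _ _).trans (le_of_eq ?_))
    rw [Measure.finsetSum_apply]
    exact Finset.sum_congr rfl fun x _ => (Measure.restrict_apply hA).symm
  exact hsum.mono hle hle

/-- On a set `A` of positive measure, possibly contained in the boundary, the `L²`-norm of a
`C¹` function together with its Dirichlet energy controls the `L²`-norm on the domain and its
boundary. -/
theorem IsBoundedLipschitzDomain.exists_lintegral_sq_le (hΩ : IsBoundedLipschitzDomain Ω)
    {A : Set (Euc d)} (hA : closureMeasure Ω A ≠ 0) :
    ∃ C : ℝ≥0∞, C ≠ ⊤ ∧ ∀ φ : Euc d → ℝ, ContDiff ℝ 1 φ →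
      ∫⁻ x, ‖φ x‖ₑ ^ 2 ∂(closureMeasure Ω) ≤
        C * ((∫⁻ x in A, ‖φ x‖ₑ ^ 2 ∂(closureMeasure Ω)) + ∫⁻ x in Ω, ‖fderiv ℝ φ x‖ₑ ^ 2) := by
  have := hΩ.isFiniteMeasure
  set m := closureMeasure Ω
  obtain ⟨C, hC, h⟩ : IsPoincareLinked Ω m (m.restrict A) :=
    hΩ.isPoincareLinked.mono le_rfl Measure.restrict_le_self
  have hAt : m A ≠ ⊤ := measure_ne_top _ _
  refine ⟨2 * (m Set.univ + C) / m A, ENNReal.div_ne_top (by finiteness) hA, fun φ hφ => ?_⟩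
  rw [div_eq_mul_inv, mul_right_comm, ← div_eq_mul_inv, ENNReal.le_div_iff_mul_le (.inl hA)
    (.inl hAt)]
  have hφc := hφ.continuous
  have hm1 : ∀ x, Measurable fun y => ‖φ x - φ y‖ₑ ^ 2 := fun x =>
    (measurable_enorm_sub_sq hφ).comp (measurable_const.prodMk measurable_id)
  set I := ∫⁻ x in A, ‖φ x‖ₑ ^ 2 ∂m
  set D := ∫⁻ x in Ω, ‖fderiv ℝ φ x‖ₑ ^ 2
  calc (∫⁻ x, ‖φ x‖ₑ ^ 2 ∂m) * m A = ∫⁻ x, (∫⁻ y in A, ‖φ x‖ₑ ^ 2 ∂m) ∂m := by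
        simp only [setLIntegral_const]
        rw [lintegral_mul_const' _ _ hAt]
    _ ≤ ∫⁻ x, 2 * ((∫⁻ y in A, ‖φ x - φ y‖ₑ ^ 2 ∂m) + I) ∂m := by
        refine lintegral_mono fun x => ?_
        rw [← lintegral_add_left (hm1 x), ← lintegral_const_mul' _ _ (by simp)]
        refine lintegral_mono fun y => ?_
        simpa using enorm_sub_sq_le_two_mul (φ x) (φ y) 0
    _ = 2 * ((∫⁻ x, ∫⁻ y in A, ‖φ x - φ y‖ₑ ^ 2 ∂m ∂m) + m Set.univ * I) := by
        rw [lintegral_const_mul' _ _ (by simp), lintegral_add_right _ measurable_const,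
          lintegral_const, mul_comm I]
    _ ≤ 2 * (C * D + m Set.univ * I) := by
        gcongr
        exact h φ hφ
    _ ≤ 2 * (m Set.univ + C) * (I + D) := by
        rw [mul_assoc]
        gcongr 2 * ?_
        rw [add_mul, mul_add, mul_add, add_comm (C * D)]
        exact add_le_add le_self_add le_add_self

end Poincare

/-! ### Weak gradients -/

section WeakGradient

variable {d : ℕ} {Ω : Set (Euc d)}

lemma MeasureTheory.LocallyIntegrableOn.integrable_mul_of_tsupport_subset {f φ : Euc d → ℝ}
    (hf : LocallyIntegrableOn f Ω volume) (hφ : Continuous φ) (hc : HasCompactSupport φ)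
    (hs : tsupport φ ⊆ Ω) : Integrable (fun x => f x * φ x) (volume.restrict Ω) := by
  have h1 : IntegrableOn (fun x => f x * φ x) (tsupport φ) volume :=
    (hf.integrableOn_compact_subset hs hc).mul_continuousOn hφ.continuousOn hc
  refine Integrable.mono_measure ?_ Measure.restrict_le_self
  refine (integrableOn_iff_integrable_of_support_subset ?_).1 h1
  intro x hx
  exact subset_tsupport _ (right_ne_zero_of_mul hx)

lemma MeasureTheory.LocallyIntegrableOn.apply {G : Euc d → Euc d}
    (hG : LocallyIntegrableOn G Ω volume) (i : Fin d) :
    LocallyIntegrableOn (fun x => G x i) Ω volume := fun x hx => by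
  obtain ⟨s, hs, hi⟩ := hG x hx
  exact ⟨s, hs, (EuclideanSpace.proj (𝕜 := ℝ) i).integrable_comp hi⟩

lemma HasWeakGradient.congr {u v : Euc d → ℝ} {G H : Euc d → Euc d} (h : HasWeakGradient Ω u G)
    (huv : u =ᵐ[volume.restrict Ω] v) (hGH : G =ᵐ[volume.restrict Ω] H) :
    HasWeakGradient Ω v H where
  locallyIntegrableOn := h.locallyIntegrableOn.congr huv
  locallyIntegrableOn_grad := h.locallyIntegrableOn_grad.congr hGH
  integral_eq φ hφ hc hs i := by
    have h1 : ∫ x in Ω, v x * fderiv ℝ φ x (EuclideanSpace.single i 1) =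
        ∫ x in Ω, u x * fderiv ℝ φ x (EuclideanSpace.single i 1) :=
      integral_congr_ae (huv.symm.mul (ae_eq_refl _))
    rw [h1, h.integral_eq φ hφ hc hs i]
    congr 1
    refine integral_congr_ae ?_
    filter_upwards [hGH] with x hx
    rw [hx]

/-- Weak gradients are unique, by the fundamental lemma of the calculus of variations. -/
lemma HasWeakGradient.ae_eq (hΩ : IsOpen Ω) {u : Euc d → ℝ} {G H : Euc d → Euc d}
    (hG : HasWeakGradient Ω u G) (hH : HasWeakGradient Ω u H) : G =ᵐ[volume.restrict Ω] H := by
  have key : ∀ i : Fin d, ∀ᵐ x ∂volume, x ∈ Ω → G x i - H x i = 0 := by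
    intro i
    have hGi := hG.locallyIntegrableOn_grad.apply i
    have hHi := hH.locallyIntegrableOn_grad.apply i
    refine hΩ.ae_eq_zero_of_integral_contDiff_smul_eq_zero (hGi.sub hHi) fun φ hφ hc hs => ?_
    have h1 : ∫ x in Ω, G x i * φ x = ∫ x in Ω, H x i * φ x := by
      have := (hG.integral_eq φ hφ hc hs i).symm.trans (hH.integral_eq φ hφ hc hs i)
      exact neg_injective this
    rw [← setIntegral_eq_integral_of_forall_compl_eq_zero (s := Ω)]
    · have h2 := integral_sub (hGi.integrable_mul_of_tsupport_subset hφ.continuous hc hs)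
        (hHi.integrable_mul_of_tsupport_subset hφ.continuous hc hs)
      rw [h1, sub_self] at h2
      rw [← h2]
      refine integral_congr_ae (Eventually.of_forall fun x => ?_)
      simp only [smul_eq_mul]
      ring
    · intro x hx
      rw [image_eq_zero_of_notMem_tsupport fun h => hx (hs h), zero_smul]
  have := ae_all_iff.2 key
  rw [Filter.EventuallyEq, ae_restrict_iff' hΩ.measurableSet]
  filter_upwards [this] with x hx hxΩ
  ext i
  exact sub_eq_zero.1 (hx i hxΩ)

lemma HasWeakGradient.weakGrad_ae_eq (hΩ : IsOpen Ω) {u : Euc d → ℝ} {G : Euc d → Euc d}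
    (h : HasWeakGradient Ω u G) : weakGrad Ω u =ᵐ[volume.restrict Ω] G := by
  have hex : ∃ G, HasWeakGradient Ω u G := ⟨G, h⟩
  rw [weakGrad, dif_pos hex]
  exact hex.choose_spec.ae_eq hΩ h

lemma HasWeakGradient.sub {u v : Euc d → ℝ} {G H : Euc d → Euc d} (hu : HasWeakGradient Ω u G)
    (hv : HasWeakGradient Ω v H) : HasWeakGradient Ω (u - v) (G - H) where
  locallyIntegrableOn := hu.locallyIntegrableOn.sub hv.locallyIntegrableOn
  locallyIntegrableOn_grad := hu.locallyIntegrableOn_grad.sub hv.locallyIntegrableOn_grad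
  integral_eq φ hφ hc hs i := by
    have hd : Continuous fun x => fderiv ℝ φ x (EuclideanSpace.single i 1) :=
      (hφ.continuous_fderiv (by simp)).clm_apply continuous_const
    have hs' : tsupport (fun x => fderiv ℝ φ x (EuclideanSpace.single i 1)) ⊆ tsupport φ :=
      tsupport_fderiv_apply_subset ℝ _
    have hc' : HasCompactSupport fun x => fderiv ℝ φ x (EuclideanSpace.single i 1) :=
      hc.fderiv_apply ℝ _
    have hs'' := hs'.trans hs
    simp only [Pi.sub_apply, PiLp.sub_apply, sub_mul]
    rw [integral_sub (hu.locallyIntegrableOn.integrable_mul_of_tsupport_subset hd hc' hs'')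
        (hv.locallyIntegrableOn.integrable_mul_of_tsupport_subset hd hc' hs''),
      integral_sub ((hu.locallyIntegrableOn_grad.apply i).integrable_mul_of_tsupport_subset
        hφ.continuous hc hs) ((hv.locallyIntegrableOn_grad.apply i).integrable_mul_of_tsupport_subset
        hφ.continuous hc hs), hu.integral_eq φ hφ hc hs i, hv.integral_eq φ hφ hc hs i]
    ring

lemma gradient_apply {φ : Euc d → ℝ} (x : Euc d) (i : Fin d) :
    gradient φ x i = fderiv ℝ φ x (EuclideanSpace.single i 1) := by
  rw [← inner_gradient_left, real_inner_comm, EuclideanSpace.inner_single_left]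
  simp

lemma norm_gradient (φ : Euc d → ℝ) (x : Euc d) : ‖gradient φ x‖ = ‖fderiv ℝ φ x‖ :=
  LinearIsometryEquiv.norm_map _ _

lemma continuous_gradient {φ : Euc d → ℝ} (hφ : ContDiff ℝ 1 φ) : Continuous (gradient φ) :=
  (InnerProductSpace.toDual ℝ (Euc d)).symm.continuous.comp (hφ.continuous_fderiv one_ne_zero)

lemma hasWeakGradient_gradient {u : Euc d → ℝ} (hu : ContDiff ℝ 1 u) :
    HasWeakGradient Ω u (gradient u) where
  locallyIntegrableOn := hu.continuous.locallyIntegrable.locallyIntegrableOn _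
  locallyIntegrableOn_grad := (continuous_gradient hu).locallyIntegrable.locallyIntegrableOn _
  integral_eq φ hφ hc hs i := by
    have hd : Continuous fun x => fderiv ℝ φ x (EuclideanSpace.single i 1) :=
      (hφ.continuous_fderiv (by simp)).clm_apply continuous_const
    have hdu : Continuous fun x => fderiv ℝ u x (EuclideanSpace.single i 1) :=
      (hu.continuous_fderiv one_ne_zero).clm_apply continuous_const
    have hs' : tsupport (fun x => fderiv ℝ φ x (EuclideanSpace.single i 1)) ⊆ tsupport φ :=
      tsupport_fderiv_apply_subset ℝ _
    have hc' : HasCompactSupport fun x => fderiv ℝ φ x (EuclideanSpace.single i 1) :=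
      hc.fderiv_apply ℝ _
    rw [setIntegral_eq_integral_of_forall_compl_eq_zero fun x hx => ?_,
      setIntegral_eq_integral_of_forall_compl_eq_zero fun x hx => ?_]
    · simp_rw [gradient_apply]
      refine integral_mul_fderiv_eq_neg_fderiv_mul_of_integrable ?_ ?_ ?_ ?_ ?_
      · exact (hdu.mul hφ.continuous).integrable_of_hasCompactSupport hc.mul_left
      · exact (hu.continuous.mul hd).integrable_of_hasCompactSupport hc'.mul_left
      · exact (hu.continuous.mul hφ.continuous).integrable_of_hasCompactSupport hc.mul_left
      · exact fun x _ => hu.differentiable one_ne_zero x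
      · exact fun x _ => hφ.differentiable (by simp) x
    · rw [image_eq_zero_of_notMem_tsupport fun h => hx (hs h), mul_zero]
    · rw [image_eq_zero_of_notMem_tsupport (f := fun x => fderiv ℝ φ x (EuclideanSpace.single i 1))
        fun h => hx (hs (hs' h)), mul_zero]

end WeakGradient

/-! ### The Hilbert space of functions with a trace -/

section ClosureMeasure

variable {d : ℕ} {Ω : Set (Euc d)}

lemma volume_restrict_le_closureMeasure : volume.restrict Ω ≤ closureMeasure Ω := by
  rw [closureMeasure]; exact Measure.le_add_right le_rfl

lemma surfaceMeasure_restrict_le_closureMeasure :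
    (surfaceMeasure d).restrict (frontier Ω) ≤ closureMeasure Ω := by
  rw [closureMeasure]; exact Measure.le_add_left le_rfl

lemma ae_eq_restrict_of_closureMeasure {u v : Euc d → ℝ} (h : u =ᵐ[closureMeasure Ω] v) :
    u =ᵐ[volume.restrict Ω] v :=
  volume_restrict_le_closureMeasure.absolutelyContinuous.ae_eq h

lemma ae_eq_restrict_frontier_of_closureMeasure {u v : Euc d → ℝ}
    (h : u =ᵐ[closureMeasure Ω] v) : u =ᵐ[(surfaceMeasure d).restrict (frontier Ω)] v :=
  surfaceMeasure_restrict_le_closureMeasure.absolutelyContinuous.ae_eq h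

lemma closureMeasure_restrict_self (hΩ : IsOpen Ω) :
    (closureMeasure Ω).restrict Ω = volume.restrict Ω := by
  rw [closureMeasure, Measure.restrict_add, Measure.restrict_restrict hΩ.measurableSet,
    Measure.restrict_restrict hΩ.measurableSet, hΩ.inter_frontier_eq, Set.inter_self]
  simp

lemma closureMeasure_restrict_of_subset_frontier (hΩ : IsOpen Ω) {Γ : Set (Euc d)}
    (hΓ : MeasurableSet Γ) (hΓΩ : Γ ⊆ frontier Ω) :
    (closureMeasure Ω).restrict Γ = (surfaceMeasure d).restrict Γ := by
  have h : Γ ∩ Ω = ∅ := by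
    rw [Set.inter_comm]
    exact Set.subset_eq_empty (Set.inter_subset_inter_right _ hΓΩ) hΩ.inter_frontier_eq
  rw [closureMeasure, Measure.restrict_add, Measure.restrict_restrict hΓ,
    Measure.restrict_restrict hΓ, h, Set.inter_eq_left.2 hΓΩ]
  simp

lemma closureMeasure_restrict_frontier (hΩ : IsOpen Ω) :
    (closureMeasure Ω).restrict (frontier Ω) = (surfaceMeasure d).restrict (frontier Ω) :=
  closureMeasure_restrict_of_subset_frontier hΩ isClosed_frontier.measurableSet subset_rfl

/-- The function which is `a` on `Ω` and `b` on `∂Ω`. -/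
noncomputable def glue (Ω : Set (Euc d)) (a b : Euc d → ℝ) : Euc d → ℝ :=
  Ω.indicator a + (frontier Ω).indicator b

variable {a b : Euc d → ℝ}

lemma glue_of_mem (hΩ : IsOpen Ω) {x : Euc d} (hx : x ∈ Ω) : glue Ω a b x = a x := by
  have : x ∉ frontier Ω := fun h => (Set.eq_empty_iff_forall_notMem.1 hΩ.inter_frontier_eq) x ⟨hx, h⟩
  simp [glue, hx, this]

lemma glue_of_mem_frontier (hΩ : IsOpen Ω) {x : Euc d} (hx : x ∈ frontier Ω) :
    glue Ω a b x = b x := by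
  have : x ∉ Ω := fun h => (Set.eq_empty_iff_forall_notMem.1 hΩ.inter_frontier_eq) x ⟨h, hx⟩
  simp [glue, hx, this]

lemma memLp_glue (hΩ : IsOpen Ω) (ha : MemLp a 2 (volume.restrict Ω))
    (hb : MemLp b 2 ((surfaceMeasure d).restrict (frontier Ω))) :
    MemLp (glue Ω a b) 2 (closureMeasure Ω) := by
  refine MemLp.add ?_ ?_
  · rwa [memLp_indicator_iff_restrict hΩ.measurableSet, closureMeasure_restrict_self hΩ]
  · rwa [memLp_indicator_iff_restrict isClosed_frontier.measurableSet,
      closureMeasure_restrict_frontier hΩ]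

lemma eLpNorm_glue_le (hΩ : IsOpen Ω) (ha : AEStronglyMeasurable a (volume.restrict Ω))
    (hb : AEStronglyMeasurable b ((surfaceMeasure d).restrict (frontier Ω))) :
    eLpNorm (glue Ω a b) 2 (closureMeasure Ω) ≤ eLpNorm a 2 (volume.restrict Ω) +
      eLpNorm b 2 ((surfaceMeasure d).restrict (frontier Ω)) := by
  have hf : MeasurableSet (frontier Ω) := isClosed_frontier.measurableSet
  refine (eLpNorm_add_le ?_ ?_ (by norm_num)).trans (le_of_eq ?_)
  · rwa [aestronglyMeasurable_indicator_iff hΩ.measurableSet, closureMeasure_restrict_self hΩ]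
  · rwa [aestronglyMeasurable_indicator_iff hf, closureMeasure_restrict_frontier hΩ]
  · rw [eLpNorm_indicator_eq_eLpNorm_restrict hΩ.measurableSet, closureMeasure_restrict_self hΩ,
      eLpNorm_indicator_eq_eLpNorm_restrict hf, closureMeasure_restrict_frontier hΩ]

lemma ae_eq_glue (hΩ : IsOpen Ω) {u : Euc d → ℝ} (ha : u =ᵐ[volume.restrict Ω] a)
    (hb : u =ᵐ[(surfaceMeasure d).restrict (frontier Ω)] b) :
    u =ᵐ[closureMeasure Ω] glue Ω a b := by
  rw [Filter.EventuallyEq, closureMeasure, ae_add_measure_iff]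
  constructor
  · filter_upwards [ha, ae_restrict_mem hΩ.measurableSet] with x hx hxΩ
    rw [hx, glue_of_mem hΩ hxΩ]
  · filter_upwards [hb, ae_restrict_mem isClosed_frontier.measurableSet] with x hx hxΩ
    rw [hx, glue_of_mem_frontier hΩ hxΩ]

lemma glue_ae_eq_left (hΩ : IsOpen Ω) : glue Ω a b =ᵐ[volume.restrict Ω] a := by
  filter_upwards [ae_restrict_mem hΩ.measurableSet] with x hx using glue_of_mem hΩ hx

lemma glue_ae_eq_right (hΩ : IsOpen Ω) :
    glue Ω a b =ᵐ[(surfaceMeasure d).restrict (frontier Ω)] b := by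
  filter_upwards [ae_restrict_mem isClosed_frontier.measurableSet] with x hx
    using glue_of_mem_frontier hΩ hx

end ClosureMeasure

lemma eLpNorm_two_sq_eq_lintegral {α F : Type*} [MeasurableSpace α] [NormedAddCommGroup F]
    {μ : Measure α} (f : α → F) : eLpNorm f 2 μ ^ 2 = ∫⁻ x, ‖f x‖ₑ ^ 2 ∂μ := by
  have h := eLpNorm_nnreal_pow_eq_lintegral (μ := μ) (f := f) (p := 2) two_ne_zero
  simpa using h

section TraceSpace

variable {d : ℕ} {Ω : Set (Euc d)}

/-- The Hilbert space of pairs `(u, G)` of a function `u` on `Ω ∪ ∂Ω` and a vector field `G` on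
`Ω`, both square integrable. -/
abbrev PairSpace (Ω : Set (Euc d)) : Type :=
  WithLp 2 (Lp ℝ 2 (closureMeasure Ω) × Lp (Euc d) 2 (volume.restrict Ω))

/-- The pairs `(φ, ∇φ)` with `φ` smooth on the whole space. -/
noncomputable def smoothPairs (Ω : Set (Euc d)) : Submodule ℝ (PairSpace Ω) where
  carrier := {w | ∃ φ : Euc d → ℝ, ContDiff ℝ ∞ φ ∧ w.fst =ᵐ[closureMeasure Ω] φ ∧
    w.snd =ᵐ[volume.restrict Ω] gradient φ}
  zero_mem' := by
    refine ⟨fun _ => 0, contDiff_const, Lp.coeFn_zero _ _ _, ?_⟩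
    refine (Lp.coeFn_zero _ _ _).trans (Eventually.of_forall fun x => ?_)
    simp [gradient]
  add_mem' := by
    rintro w w' ⟨φ, hφ, h1, h2⟩ ⟨φ', hφ', h1', h2'⟩
    refine ⟨φ + φ', hφ.add hφ', (Lp.coeFn_add _ _).trans (h1.add h1'), ?_⟩
    refine (Lp.coeFn_add _ _).trans ((h2.add h2').trans (Eventually.of_forall fun x => ?_))
    simp only [gradient, Pi.add_apply]
    rw [fderiv_add (hφ.differentiable (by simp) x) (hφ'.differentiable (by simp) x), map_add]
  smul_mem' := by
    rintro c w ⟨φ, hφ, h1, h2⟩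
    refine ⟨c • φ, contDiff_const.smul hφ, (Lp.coeFn_smul _ _).trans (h1.const_smul c), ?_⟩
    refine (Lp.coeFn_smul _ _).trans ((h2.const_smul c).trans (Eventually.of_forall fun x => ?_))
    simp only [gradient, Pi.smul_apply]
    rw [fderiv_const_smul (hφ.differentiable (by simp) x), map_smul]

/-- The pairs `(u, ∇u)`, where `u` consists of an `H¹`-function on `Ω` and its trace on `∂Ω`. -/
noncomputable def traceSpace (Ω : Set (Euc d)) : Submodule ℝ (PairSpace Ω) := (smoothPairs Ω).topologicalClosure

/-- The elements of the trace space vanishing on `ΓD`. -/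
noncomputable def dirichletSpace (Ω ΓD : Set (Euc d)) : Submodule ℝ (PairSpace Ω) :=
  traceSpace Ω ⊓ ((LpToLpRestrictCLM (Euc d) ℝ ℝ (closureMeasure Ω) 2 ΓD).comp
    (WithLp.fstL 2 ℝ (Lp ℝ 2 (closureMeasure Ω)) (Lp (Euc d) 2 (volume.restrict Ω)))).ker

lemma isClosed_traceSpace : IsClosed (traceSpace Ω : Set (PairSpace Ω)) :=
  Submodule.isClosed_topologicalClosure _

lemma isClosed_dirichletSpace (ΓD : Set (Euc d)) :
    IsClosed (dirichletSpace Ω ΓD : Set (PairSpace Ω)) :=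
  isClosed_traceSpace.inter (ContinuousLinearMap.isClosed_ker _)

lemma mem_dirichletSpace_iff {ΓD : Set (Euc d)} {w : PairSpace Ω} :
    w ∈ dirichletSpace Ω ΓD ↔
      w ∈ traceSpace Ω ∧ ∀ᵐ x ∂((closureMeasure Ω).restrict ΓD), w.fst x = 0 := by
  refine and_congr_right fun _ => ?_
  change LpToLpRestrictCLM (Euc d) ℝ ℝ (closureMeasure Ω) 2 ΓD w.fst = 0 ↔ _
  rw [Lp.eq_zero_iff_ae_eq_zero]
  have h := LpToLpRestrictCLM_coeFn ℝ (p := 2) ΓD w.fst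
  exact ⟨fun h0 => h.symm.trans h0, fun h0 => h.trans h0⟩

lemma enorm_pair_sq (w : PairSpace Ω) : ‖w‖ₑ ^ 2 = ‖w.fst‖ₑ ^ 2 + ‖w.snd‖ₑ ^ 2 := by
  have h : ‖w‖₊ ^ 2 = ‖w.fst‖₊ ^ 2 + ‖w.snd‖₊ ^ 2 := by
    rw [WithLp.prod_nnnorm_eq_of_L2, NNReal.sq_sqrt]
  simp only [enorm_eq_nnnorm]
  exact_mod_cast h

lemma memLp_of_continuous {F : Type*} [NormedAddCommGroup F] [SecondCountableTopology F]
    (hΩ : IsBoundedLipschitzDomain Ω) {u : Euc d → F} (hu : Continuous u) :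
    MemLp u 2 (closureMeasure Ω) := by
  have := hΩ.isFiniteMeasure
  obtain ⟨C, hC⟩ := hΩ.isCompact_closure.exists_bound_of_continuousOn hu.continuousOn
  refine MemLp.of_bound hu.aestronglyMeasurable C ?_
  filter_upwards [ae_closureMeasure_mem_closure hΩ.isOpen.measurableSet] with x hx using hC x hx

/-- The element of the trace space given by a smooth function. -/
noncomputable def smoothPair (hΩ : IsBoundedLipschitzDomain Ω) {φ : Euc d → ℝ}
    (hφ : ContDiff ℝ ∞ φ) : PairSpace Ω :=
  WithLp.toLp 2 ((memLp_of_continuous hΩ hφ.continuous).toLp φ,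
    ((memLp_of_continuous hΩ (continuous_gradient (hφ.of_le (by simp)))).mono_measure
      volume_restrict_le_closureMeasure).toLp (gradient φ))

lemma smoothPair_mem (hΩ : IsBoundedLipschitzDomain Ω) {φ : Euc d → ℝ} (hφ : ContDiff ℝ ∞ φ) :
    smoothPair hΩ hφ ∈ smoothPairs Ω :=
  ⟨φ, hφ, (memLp_of_continuous hΩ hφ.continuous).coeFn_toLp,
    ((memLp_of_continuous hΩ (continuous_gradient (hφ.of_le (by simp)))).mono_measure
      volume_restrict_le_closureMeasure).coeFn_toLp⟩

lemma memLp_fst (w : PairSpace Ω) : MemLp w.fst 2 (volume.restrict Ω) :=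
  (Lp.memLp w.fst).mono_measure volume_restrict_le_closureMeasure

/-- The defining identity of weak gradients passes to `L²`-limits, as both sides are continuous. -/
lemma hasWeakGradient_of_mem (hΩ : IsBoundedLipschitzDomain Ω) {w : PairSpace Ω}
    (hw : w ∈ traceSpace Ω) : HasWeakGradient Ω w.fst w.snd := by
  have := hΩ.isFiniteMeasure
  have : IsFiniteMeasure (volume.restrict Ω) :=
    isFiniteMeasure_of_le _ volume_restrict_le_closureMeasure
  have hfst : ∀ w : PairSpace Ω, Integrable w.fst (volume.restrict Ω) := fun w =>
    (memLp_fst w).integrable (by norm_num)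
  have hsnd : ∀ w : PairSpace Ω, Integrable w.snd (volume.restrict Ω) := fun w =>
    (Lp.memLp w.snd).integrable (by norm_num)
  refine ⟨IntegrableOn.locallyIntegrableOn (hfst w), IntegrableOn.locallyIntegrableOn (hsnd w),
    fun ψ hψ hc hs i => ?_⟩
  have hd : Continuous fun x => fderiv ℝ ψ x (EuclideanSpace.single i 1) :=
    (hψ.continuous_fderiv (by simp)).clm_apply continuous_const
  have hs' : tsupport (fun x => fderiv ℝ ψ x (EuclideanSpace.single i 1)) ⊆ tsupport ψ :=
    tsupport_fderiv_apply_subset ℝ _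
  have ha := memLp_of_continuous hΩ hd
  have hb : MemLp (fun x => ψ x • (EuclideanSpace.single i 1 : Euc d)) 2 (volume.restrict Ω) :=
    (memLp_of_continuous hΩ (hψ.continuous.smul continuous_const)).mono_measure
      volume_restrict_le_closureMeasure
  have h1 : ∀ w : PairSpace Ω, ⟪ha.toLp _, w.fst⟫_ℝ =
      ∫ x in Ω, w.fst x * fderiv ℝ ψ x (EuclideanSpace.single i 1) := by
    intro w
    have h : ∫ x in Ω, w.fst x * fderiv ℝ ψ x (EuclideanSpace.single i 1) =
        ∫ x in Ω, w.fst x * fderiv ℝ ψ x (EuclideanSpace.single i 1) ∂(closureMeasure Ω) :=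
      congrArg (fun μ => ∫ x, w.fst x * fderiv ℝ ψ x (EuclideanSpace.single i 1) ∂μ)
        (closureMeasure_restrict_self hΩ.isOpen).symm
    rw [L2.inner_def, h, setIntegral_eq_integral_of_forall_compl_eq_zero]
    · refine integral_congr_ae ?_
      filter_upwards [ha.coeFn_toLp] with x hx
      rw [hx]
      simp
    · intro x hx
      rw [image_eq_zero_of_notMem_tsupport (f := fun x => fderiv ℝ ψ x (EuclideanSpace.single i 1))
        fun h => hx (hs (hs' h)), mul_zero]
  have h2 : ∀ w : PairSpace Ω, ⟪hb.toLp _, w.snd⟫_ℝ = ∫ x in Ω, w.snd x i * ψ x := by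
    intro w
    rw [L2.inner_def]
    refine integral_congr_ae ?_
    filter_upwards [hb.coeFn_toLp] with x hx
    rw [hx, inner_smul_left, EuclideanSpace.inner_single_left]
    simp [mul_comm]
  rw [← h1, ← h2]
  have hcl : IsClosed {w : PairSpace Ω | ⟪ha.toLp _, w.fst⟫_ℝ = -⟪hb.toLp _, w.snd⟫_ℝ} := by
    refine isClosed_eq ?_ ?_
    · exact continuous_const.inner (WithLp.fstL 2 ℝ _ _).continuous
    · exact (continuous_const.inner (WithLp.sndL 2 ℝ _ _).continuous).neg
  refine closure_minimal ?_ hcl hw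
  rintro w ⟨φ, hφ, hw1, hw2⟩
  rw [Set.mem_ofPred_eq, h1, h2]
  have hw1' : w.fst =ᵐ[volume.restrict Ω] φ :=
    ae_eq_restrict_of_closureMeasure hw1
  exact ((hasWeakGradient_gradient (hφ.of_le (by simp))).congr hw1'.symm hw2.symm).integral_eq
    ψ hψ hc hs i

lemma le_h1Norm (u : Euc d → ℝ) : eLpNorm u 2 (volume.restrict Ω) ≤ h1Norm Ω u ∧
    eLpNorm (weakGrad Ω u) 2 (volume.restrict Ω) ≤ h1Norm Ω u := by
  have h : ∀ a : ℝ≥0∞, a = (a ^ 2) ^ (1 / 2 : ℝ) := fun a => by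
    rw [← ENNReal.rpow_natCast, ← ENNReal.rpow_mul]; norm_num
  constructor
  · rw [h1Norm]
    conv_lhs => rw [h (eLpNorm u 2 (volume.restrict Ω))]
    gcongr
    exact le_self_add
  · rw [h1Norm]
    conv_lhs => rw [h (eLpNorm (weakGrad Ω u) 2 (volume.restrict Ω))]
    gcongr
    exact le_add_self

lemma h1Norm_le_enorm (hΩ : IsBoundedLipschitzDomain Ω) {w : PairSpace Ω}
    (hw : w ∈ traceSpace Ω) {u : Euc d → ℝ} (hu : u =ᵐ[volume.restrict Ω] w.fst) :
    h1Norm Ω u ≤ ‖w‖ₑ := by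
  have hG := ((hasWeakGradient_of_mem hΩ hw).congr hu.symm (ae_eq_refl _)).weakGrad_ae_eq hΩ.isOpen
  have h1 : eLpNorm u 2 (volume.restrict Ω) ≤ ‖w.fst‖ₑ := by
    rw [eLpNorm_congr_ae hu, Lp.enorm_def]
    exact eLpNorm_mono_measure _ volume_restrict_le_closureMeasure
  have h2 : eLpNorm (weakGrad Ω u) 2 (volume.restrict Ω) = ‖w.snd‖ₑ := by
    rw [eLpNorm_congr_ae hG, Lp.enorm_def]
  calc h1Norm Ω u ≤ (‖w.fst‖ₑ ^ 2 + ‖w.snd‖ₑ ^ 2) ^ (1 / 2 : ℝ) := by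
        rw [h1Norm, h2]
        gcongr
    _ = ‖w‖ₑ := by
        rw [← enorm_pair_sq, ← ENNReal.rpow_natCast, ← ENNReal.rpow_mul]
        norm_num

lemma isTrace_of_mem (hΩ : IsBoundedLipschitzDomain Ω) {w : PairSpace Ω}
    (hw : w ∈ traceSpace Ω) : IsTrace Ω w.fst w.fst := by
  refine ⟨⟨memLp_fst w, w.snd, hasWeakGradient_of_mem hΩ hw, Lp.memLp _⟩,
    (Lp.memLp w.fst).mono_measure surfaceMeasure_restrict_le_closureMeasure, ?_⟩
  obtain ⟨x, hx, hlim⟩ := mem_closure_iff_seq_limit.1 hw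
  choose φ hφ hφ1 hφ2 using hx
  have hsub : ∀ n, φ n - ⇑w.fst =ᵐ[closureMeasure Ω] (x n - w).fst := fun n =>
    ((hφ1 n).symm.sub (ae_eq_refl _)).trans (Lp.coeFn_sub _ _).symm
  have hxw : Tendsto (fun n => ‖x n - w‖ₑ) atTop (𝓝 0) := by
    have h0 : Tendsto (fun n => x n - w) atTop (𝓝 0) := by simpa using hlim.sub_const w
    simpa using h0.enorm
  refine ⟨φ, hφ, ?_, ?_⟩
  · refine tendsto_of_tendsto_of_tendsto_of_le_of_le tendsto_const_nhds hxw (fun _ => zero_le) ?_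
    intro n
    exact h1Norm_le_enorm hΩ
      ((traceSpace Ω).sub_mem
        ((smoothPairs Ω).le_topologicalClosure ⟨φ n, hφ n, hφ1 n, hφ2 n⟩) hw)
      (ae_eq_restrict_of_closureMeasure (hsub n))
  · refine tendsto_of_tendsto_of_tendsto_of_le_of_le tendsto_const_nhds hxw (fun _ => zero_le) ?_
    intro n
    calc _ ≤ eLpNorm (φ n - ⇑w.fst) 2 (closureMeasure Ω) :=
          eLpNorm_mono_measure _ surfaceMeasure_restrict_le_closureMeasure
      _ = ‖(x n - w).fst‖ₑ := by rw [eLpNorm_congr_ae (hsub n), Lp.enorm_def]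
      _ ≤ ‖x n - w‖ₑ := by
          rw [← ENNReal.pow_le_pow_left_iff two_ne_zero, enorm_pair_sq]
          exact le_self_add

/-- Every `H¹`-function with a trace defines an element of the trace space. -/
lemma IsTrace.exists_mem (hΩ : IsBoundedLipschitzDomain Ω) {q t : Euc d → ℝ}
    (h : IsTrace Ω q t) : ∃ w ∈ traceSpace Ω, w.fst =ᵐ[volume.restrict Ω] q ∧
      w.fst =ᵐ[(surfaceMeasure d).restrict (frontier Ω)] t ∧
      w.snd =ᵐ[volume.restrict Ω] weakGrad Ω q := by
  obtain ⟨⟨hq, G, hG, hGL⟩, ht, φ, hφ, hlim1, hlim2⟩ := h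
  have ho := hΩ.isOpen
  have hg := memLp_glue ho hq ht
  have hw1 : hg.toLp _ =ᵐ[volume.restrict Ω] q :=
    (ae_eq_restrict_of_closureMeasure hg.coeFn_toLp).trans (glue_ae_eq_left ho)
  have hw2 : hg.toLp _ =ᵐ[(surfaceMeasure d).restrict (frontier Ω)] t :=
    (ae_eq_restrict_frontier_of_closureMeasure hg.coeFn_toLp).trans (glue_ae_eq_right ho)
  refine ⟨WithLp.toLp 2 (hg.toLp _, hGL.toLp _), ?_, hw1, hw2,
    hGL.coeFn_toLp.trans (hG.weakGrad_ae_eq ho).symm⟩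
  have hlim1a : Tendsto (fun n => eLpNorm (φ n - q) 2 (volume.restrict Ω)) atTop (𝓝 0) :=
    tendsto_of_tendsto_of_tendsto_of_le_of_le tendsto_const_nhds hlim1 (fun _ => zero_le)
      fun n => (le_h1Norm _).1
  have hlim1b : Tendsto (fun n => eLpNorm (gradient (φ n) - G) 2 (volume.restrict Ω)) atTop
      (𝓝 0) := by
    refine tendsto_of_tendsto_of_tendsto_of_le_of_le tendsto_const_nhds hlim1 (fun _ => zero_le)
      fun n => ?_
    rw [← eLpNorm_congr_ae
      (((hasWeakGradient_gradient ((hφ n).of_le (by simp))).sub hG).weakGrad_ae_eq ho)]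
    exact (le_h1Norm _).2
  refine mem_closure_of_tendsto (f := fun n => smoothPair hΩ (hφ n)) (b := atTop) ?_
    (Eventually.of_forall fun n => smoothPair_mem hΩ (hφ n))
  refine ((WithLp.prod_continuous_toLp 2 _ _).tendsto _).comp (Tendsto.prodMk_nhds ?_ ?_)
  · refine (Lp.tendsto_Lp_iff_tendsto_eLpNorm'' _ _ _ _).2 ?_
    have hsum := hlim1a.add hlim2
    rw [add_zero] at hsum
    refine tendsto_of_tendsto_of_tendsto_of_le_of_le tendsto_const_nhds hsum (fun _ => zero_le)
      fun n => ?_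
    have hn : φ n - glue Ω q t =ᵐ[closureMeasure Ω] glue Ω (φ n - q) (φ n - t) :=
      ae_eq_glue ho ((ae_eq_refl _).sub (glue_ae_eq_left ho))
        ((ae_eq_refl _).sub (glue_ae_eq_right ho))
    rw [eLpNorm_congr_ae hn]
    have hc := (hφ n).continuous
    exact eLpNorm_glue_le ho (hc.aestronglyMeasurable.sub hq.1) (hc.aestronglyMeasurable.sub ht.1)
  · exact (Lp.tendsto_Lp_iff_tendsto_eLpNorm'' _ _ _ _).2 hlim1b

/-- Friedrichs' inequality: the Poincaré inequality passes from smooth functions to their closure,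
and the boundary term vanishes on the Dirichlet space. -/
lemma exists_norm_fst_le (hΩ : IsBoundedLipschitzDomain Ω) {ΓD : Set (Euc d)}
    (hΓ : closureMeasure Ω ΓD ≠ 0) :
    ∃ C : ℝ, 0 ≤ C ∧ ∀ w ∈ dirichletSpace Ω ΓD, ‖w.fst‖ ≤ C * ‖w.snd‖ := by
  obtain ⟨C, hC, h⟩ := hΩ.exists_lintegral_sq_le hΓ
  set R := LpToLpRestrictCLM (Euc d) ℝ ℝ (closureMeasure Ω) 2 ΓD
  have hcl : IsClosed {w : PairSpace Ω | ‖w.fst‖ₑ ^ 2 ≤ C * (‖R w.fst‖ₑ ^ 2 + ‖w.snd‖ₑ ^ 2)} := by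
    have h1 : Continuous fun w : PairSpace Ω => w.fst := (WithLp.fstL 2 ℝ _ _).continuous
    have h2 : Continuous fun w : PairSpace Ω => w.snd := (WithLp.sndL 2 ℝ _ _).continuous
    refine isClosed_le ((ENNReal.continuous_pow 2).comp h1.enorm) ?_
    exact (ENNReal.continuous_const_mul hC).comp
      (((ENNReal.continuous_pow 2).comp (R.continuous.comp h1).enorm).add
        ((ENNReal.continuous_pow 2).comp h2.enorm))
  have hW : ∀ w ∈ traceSpace Ω, ‖w.fst‖ₑ ^ 2 ≤ C * (‖R w.fst‖ₑ ^ 2 + ‖w.snd‖ₑ ^ 2) := by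
    refine fun w hw => closure_minimal ?_ hcl hw
    rintro w ⟨φ, hφ, h1, h2⟩
    have h3 : R w.fst =ᵐ[(closureMeasure Ω).restrict ΓD] φ :=
      (LpToLpRestrictCLM_coeFn ℝ ΓD w.fst).trans (ae_restrict_of_ae h1)
    have h4 : ∫⁻ x in Ω, ‖gradient φ x‖ₑ ^ 2 = ∫⁻ x in Ω, ‖fderiv ℝ φ x‖ₑ ^ 2 := by
      simp only [← ofReal_norm, norm_gradient]
    rw [Set.mem_ofPred_eq, Lp.enorm_def, Lp.enorm_def, Lp.enorm_def, eLpNorm_congr_ae h1,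
      eLpNorm_congr_ae h2, eLpNorm_congr_ae h3, eLpNorm_two_sq_eq_lintegral,
      eLpNorm_two_sq_eq_lintegral, eLpNorm_two_sq_eq_lintegral, h4]
    exact h φ (hφ.of_le (by simp))
  refine ⟨√C.toReal, Real.sqrt_nonneg _, fun w hw => ?_⟩
  have h1 := hW w hw.1
  rw [show R w.fst = 0 from hw.2, enorm_zero, zero_pow two_ne_zero, zero_add] at h1
  have h2 : ‖w.fst‖ ^ 2 ≤ C.toReal * ‖w.snd‖ ^ 2 := by
    have := ENNReal.toReal_mono (by finiteness) h1
    simpa using this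
  refine abs_le_of_sq_le_sq' ?_ (by positivity) |>.2
  rwa [mul_pow, Real.sq_sqrt ENNReal.toReal_nonneg]

end TraceSpace

/-! ### The weak formulation -/

section MatrixFields

variable {d : ℕ}

lemma frobNorm_nonneg (M : Matrix (Fin d) (Fin d) ℝ) : 0 ≤ frobNorm M := Real.sqrt_nonneg _

lemma norm_toEuclideanLin_le (M : Matrix (Fin d) (Fin d) ℝ) (ξ : Euc d) :
    ‖M.toEuclideanLin ξ‖ ≤ frobNorm M * ‖ξ‖ := by
  rw [frobNorm, EuclideanSpace.norm_eq, EuclideanSpace.norm_eq ξ, ← Real.sqrt_mul (by positivity)]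
  apply Real.sqrt_le_sqrt
  rw [Finset.sum_mul]
  refine Finset.sum_le_sum fun i _ => ?_
  simp only [Real.norm_eq_abs, sq_abs]
  exact Finset.sum_mul_sq_le_sq_mul_sq Finset.univ (M i) ξ

lemma aestronglyMeasurable_toEuclideanLin {μ : Measure (Euc d)}
    {A : Euc d → Matrix (Fin d) (Fin d) ℝ} (hA : ∀ i j, AEMeasurable (fun x => A x i j) μ)
    {G : Euc d → Euc d} (hG : AEMeasurable G μ) :
    AEStronglyMeasurable (fun x => (A x).toEuclideanLin (G x)) μ := by
  refine AEMeasurable.aestronglyMeasurable ?_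
  refine (MeasurableEquiv.toLp 2 (Fin d → ℝ)).measurable.comp_aemeasurable
    (f := fun x => (A x).mulVec (G x)) (aemeasurable_pi_lambda _ fun i => ?_)
  change AEMeasurable (fun x => ∑ j, A x i j * G x j) μ
  refine Finset.aemeasurable_fun_sum _ fun j _ => AEMeasurable.fun_mul (hA i j) ?_
  exact (EuclideanSpace.proj (𝕜 := ℝ) j).continuous.measurable.comp_aemeasurable hG

/-- Multiplication by an essentially bounded matrix field, as an operator on `L²`. -/
lemma exists_matrix_operator {μ : Measure (Euc d)} {A : Euc d → Matrix (Fin d) (Fin d) ℝ}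
    (hA : ∀ i j, AEMeasurable (fun x => A x i j) μ) {c : ℝ}
    (hAc : ∀ᵐ x ∂μ, frobNorm (A x) ≤ c) :
    ∃ T : Lp (Euc d) 2 μ →L[ℝ] Lp (Euc d) 2 μ, (∀ G, ‖T G‖ ≤ c * ‖G‖) ∧
      ∀ G, T G =ᵐ[μ] fun x => (A x).toEuclideanLin (G x) := by
  have hle : ∀ G : Lp (Euc d) 2 μ, ∀ᵐ x ∂μ, ‖(A x).toEuclideanLin (G x)‖ ≤ c * ‖G x‖ := by
    intro G
    filter_upwards [hAc] with x hx
    exact (norm_toEuclideanLin_le _ _).trans (by gcongr)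
  have hmem : ∀ G : Lp (Euc d) 2 μ, MemLp (fun x => (A x).toEuclideanLin (G x)) 2 μ := fun G =>
    (Lp.memLp G).of_le_mul
      (aestronglyMeasurable_toEuclideanLin hA (Lp.aestronglyMeasurable G).aemeasurable) (hle G)
  let T₀ : Lp (Euc d) 2 μ →ₗ[ℝ] Lp (Euc d) 2 μ :=
    { toFun := fun G => (hmem G).toLp _
      map_add' := fun G H => by
        refine Lp.ext ?_
        filter_upwards [(hmem (G + H)).coeFn_toLp, (hmem G).coeFn_toLp, (hmem H).coeFn_toLp,
          Lp.coeFn_add G H, Lp.coeFn_add ((hmem G).toLp _) ((hmem H).toLp _)] with x h1 h2 h3 h4 h5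
        rw [h1, h5, Pi.add_apply, h2, h3, h4, Pi.add_apply, map_add]
      map_smul' := fun r G => by
        refine Lp.ext ?_
        filter_upwards [(hmem (r • G)).coeFn_toLp, (hmem G).coeFn_toLp,
          Lp.coeFn_smul r G, Lp.coeFn_smul r ((hmem G).toLp _)] with x h1 h2 h4 h5
        rw [h1, RingHom.id_apply, h5, Pi.smul_apply, h2, h4, Pi.smul_apply, map_smul] }
  have hT₀ : ∀ G, ‖T₀ G‖ ≤ c * ‖G‖ := fun G => by
    refine Lp.norm_le_mul_norm_of_ae_le_mul ?_
    filter_upwards [hle G, (hmem G).coeFn_toLp] with x h1 h2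
    change ‖(hmem G).toLp _ x‖ ≤ _
    rw [h2]
    exact h1
  exact ⟨T₀.mkContinuous c hT₀, hT₀, fun G => (hmem G).coeFn_toLp⟩

lemma frobNorm_sub_le (M N : Matrix (Fin d) (Fin d) ℝ) :
    frobNorm (M - N) ≤ frobNorm M + frobNorm N := by
  let φ : Matrix (Fin d) (Fin d) ℝ → EuclideanSpace ℝ (Fin d × Fin d) :=
    fun M => WithLp.toLp 2 fun ij => M ij.1 ij.2
  have h : ∀ M, frobNorm M = ‖φ M‖ := by
    intro M
    rw [EuclideanSpace.norm_eq, frobNorm, Fintype.sum_prod_type]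
    simp [φ]
  rw [h, h, h]
  exact norm_sub_le (φ M) (φ N)

lemma ae_frobNorm_le_toReal_matLinftyNorm {Ω : Set (Euc d)} {A : Euc d → Matrix (Fin d) (Fin d) ℝ}
    (h : matLinftyNorm Ω A ≠ ⊤) :
    ∀ᵐ x ∂(volume.restrict Ω), frobNorm (A x) ≤ (matLinftyNorm Ω A).toReal := by
  filter_upwards [ae_le_eLpNormEssSup (f := fun x => frobNorm (A x)) (μ := volume.restrict Ω)]
    with x hx
  rw [← eLpNorm_exponent_top] at hx
  have h1 := ENNReal.toReal_mono h hx
  rwa [toReal_enorm, Real.norm_of_nonneg (frobNorm_nonneg _)] at h1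

lemma IsPermeability.matLinftyNorm_sub_ne_top {Ω : Set (Euc d)} {lam Kmax : ℝ}
    {K₁ K₂ : Euc d → Matrix (Fin d) (Fin d) ℝ} (h₁ : IsPermeability Ω lam Kmax K₁)
    (h₂ : IsPermeability Ω lam Kmax K₂) : matLinftyNorm Ω (K₂ - K₁) ≠ ⊤ := by
  rw [matLinftyNorm, eLpNorm_exponent_top]
  refine (eLpNormEssSup_lt_top_of_ae_bound (C := Kmax + Kmax) ?_).ne
  filter_upwards [h₁.bounded, h₂.bounded] with x hx₁ hx₂
  rw [Real.norm_of_nonneg (frobNorm_nonneg _), Pi.sub_apply]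
  exact (frobNorm_sub_le _ _).trans (add_le_add hx₂ hx₁)

/-- A permeability as a bounded coercive operator on square integrable vector fields. -/
lemma IsPermeability.exists_operator {Ω : Set (Euc d)} {lam Kmax : ℝ}
    {K : Euc d → Matrix (Fin d) (Fin d) ℝ} (h : IsPermeability Ω lam Kmax K) :
    ∃ T : Lp (Euc d) 2 (volume.restrict Ω) →L[ℝ] Lp (Euc d) 2 (volume.restrict Ω),
      (∀ G, ‖T G‖ ≤ |Kmax| * ‖G‖) ∧ (∀ G, lam * ‖G‖ ^ 2 ≤ ⟪T G, G⟫_ℝ) ∧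
      ∀ G, T G =ᵐ[volume.restrict Ω] fun x => (K x).toEuclideanLin (G x) := by
  obtain ⟨T, hT, hTK⟩ := exists_matrix_operator h.aemeasurable
    (h.bounded.mono fun x hx => hx.trans (le_abs_self _))
  refine ⟨T, hT, fun G => ?_, hTK⟩
  rw [← real_inner_self_eq_norm_sq, L2.inner_def, L2.inner_def, ← integral_const_mul]
  refine integral_mono_ae ((L2.integrable_inner G G).const_mul _) (L2.integrable_inner _ _) ?_
  filter_upwards [h.coercive, hTK G] with x h1 h2
  simp only [real_inner_self_eq_norm_sq]
  rw [h2]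
  exact h1 (G x)

end MatrixFields

section WeakFormulation

variable {d : ℕ} {Ω ΓD ΓF : Set (Euc d)} {f g : Euc d → ℝ}

lemma integral_closureMeasure {h : Euc d → ℝ} (hh : Integrable h (closureMeasure Ω)) :
    ∫ x, h x ∂(closureMeasure Ω) =
      (∫ x in Ω, h x) + ∫ x in frontier Ω, h x ∂(surfaceMeasure d) :=
  integral_add_measure (hh.mono_measure volume_restrict_le_closureMeasure)
    (hh.mono_measure surfaceMeasure_restrict_le_closureMeasure)

/-- The right-hand side of the weak formulation as an inner product with a fixed element of
`L²(Ω) × L²(∂Ω)`. -/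
lemma exists_load (hΩ : IsOpen Ω) (hΓF : MeasurableSet ΓF) (hΓ : ΓF ⊆ frontier Ω)
    (hf : MemLp f 2 (volume.restrict Ω)) (hg : MemLp g 2 ((surfaceMeasure d).restrict ΓF)) :
    ∃ F : Lp ℝ 2 (closureMeasure Ω), ∀ (u : Lp ℝ 2 (closureMeasure Ω)) (q t : Euc d → ℝ),
      u =ᵐ[volume.restrict Ω] q → u =ᵐ[(surfaceMeasure d).restrict (frontier Ω)] t →
      ⟪F, u⟫_ℝ = (∫ x in Ω, f x * q x) + ∫ x in ΓF, g x * t x ∂(surfaceMeasure d) := by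
  have hg' : MemLp (ΓF.indicator g) 2 ((surfaceMeasure d).restrict (frontier Ω)) := by
    rwa [memLp_indicator_iff_restrict hΓF, Measure.restrict_restrict hΓF, Set.inter_eq_left.2 hΓ]
  have hF := memLp_glue hΩ hf hg'
  refine ⟨hF.toLp _, fun u q t hq ht => ?_⟩
  rw [L2.inner_def, integral_closureMeasure (L2.integrable_inner _ _)]
  congr 1
  · refine integral_congr_ae ?_
    filter_upwards [ae_eq_restrict_of_closureMeasure hF.coeFn_toLp,
      glue_ae_eq_left (a := f) (b := ΓF.indicator g) hΩ, hq] with x h1 h2 h3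
    rw [h1, h2, h3]
    simp [mul_comm]
  · have h1 : ∫ x in ΓF, g x * t x ∂(surfaceMeasure d) =
        ∫ x in frontier Ω, ΓF.indicator (fun x => g x * t x) x ∂(surfaceMeasure d) := by
      rw [integral_indicator hΓF, Measure.restrict_restrict hΓF, Set.inter_eq_left.2 hΓ]
    rw [h1]
    refine integral_congr_ae ?_
    filter_upwards [ae_eq_restrict_frontier_of_closureMeasure hF.coeFn_toLp,
      glue_ae_eq_right (a := f) (b := ΓF.indicator g) hΩ, ht] with x h1 h2 h3
    rw [h1, h2, h3]
    by_cases hx : x ∈ ΓF <;> simp [hx, mul_comm]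

lemma IsTraceVanishingOn.exists_mem (hΩ : IsBoundedLipschitzDomain Ω) (hΓD : MeasurableSet ΓD)
    (hΓ : ΓD ⊆ frontier Ω) {q t : Euc d → ℝ} (h : IsTraceVanishingOn Ω ΓD q t) :
    ∃ w ∈ dirichletSpace Ω ΓD, w.fst =ᵐ[volume.restrict Ω] q ∧
      w.fst =ᵐ[(surfaceMeasure d).restrict (frontier Ω)] t ∧
      w.snd =ᵐ[volume.restrict Ω] weakGrad Ω q := by
  obtain ⟨w, hw, h1, h2, h3⟩ := h.1.exists_mem hΩ
  refine ⟨w, mem_dirichletSpace_iff.2 ⟨hw, ?_⟩, h1, h2, h3⟩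
  rw [closureMeasure_restrict_of_subset_frontier hΩ.isOpen hΓD hΓ]
  filter_upwards [(Measure.restrict_mono hΓ le_rfl).absolutelyContinuous.ae_eq h2, h.2]
    with x hx hx'
  rw [hx, hx']

lemma isTraceVanishingOn_of_mem (hΩ : IsBoundedLipschitzDomain Ω) (hΓD : MeasurableSet ΓD)
    (hΓ : ΓD ⊆ frontier Ω) {w : PairSpace Ω} (hw : w ∈ dirichletSpace Ω ΓD) :
    IsTraceVanishingOn Ω ΓD w.fst w.fst := by
  obtain ⟨hw1, hw2⟩ := mem_dirichletSpace_iff.1 hw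
  refine ⟨isTrace_of_mem hΩ hw1, ?_⟩
  rwa [closureMeasure_restrict_of_subset_frontier hΩ.isOpen hΓD hΓ] at hw2

lemma weakGrad_ae_eq_snd (hΩ : IsBoundedLipschitzDomain Ω) {w : PairSpace Ω}
    (hw : w ∈ dirichletSpace Ω ΓD) : weakGrad Ω w.fst =ᵐ[volume.restrict Ω] w.snd :=
  (hasWeakGradient_of_mem hΩ hw.1).weakGrad_ae_eq hΩ.isOpen

lemma inner_operator_eq_integral {K : Euc d → Matrix (Fin d) (Fin d) ℝ}
    {T : Lp (Euc d) 2 (volume.restrict Ω) →L[ℝ] Lp (Euc d) 2 (volume.restrict Ω)}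
    (hT : ∀ G, T G =ᵐ[volume.restrict Ω] fun x => (K x).toEuclideanLin (G x))
    {G H : Lp (Euc d) 2 (volume.restrict Ω)} {G' H' : Euc d → Euc d}
    (hG : G =ᵐ[volume.restrict Ω] G') (hH : H =ᵐ[volume.restrict Ω] H') :
    ⟪T G, H⟫_ℝ = ∫ x in Ω, ⟪(K x).toEuclideanLin (G' x), H' x⟫_ℝ := by
  rw [L2.inner_def]
  refine integral_congr_ae ?_
  filter_upwards [hT G, hG, hH] with x h1 h2 h3
  rw [h1, h2, h3]

/-- A Darcy solution solves the variational problem on the Dirichlet space. -/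
lemma IsDarcySolution.exists_mem (hΩ : IsBoundedLipschitzDomain Ω) (hΓD : MeasurableSet ΓD)
    (hΓ : ΓD ⊆ frontier Ω) {F : Lp ℝ 2 (closureMeasure Ω)}
    (hF : ∀ (u : Lp ℝ 2 (closureMeasure Ω)) (q t : Euc d → ℝ),
      u =ᵐ[volume.restrict Ω] q → u =ᵐ[(surfaceMeasure d).restrict (frontier Ω)] t →
      ⟪F, u⟫_ℝ = (∫ x in Ω, f x * q x) + ∫ x in ΓF, g x * t x ∂(surfaceMeasure d))
    {K : Euc d → Matrix (Fin d) (Fin d) ℝ}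
    {T : Lp (Euc d) 2 (volume.restrict Ω) →L[ℝ] Lp (Euc d) 2 (volume.restrict Ω)}
    (hT : ∀ G, T G =ᵐ[volume.restrict Ω] fun x => (K x).toEuclideanLin (G x))
    {v : Euc d → Euc d} {p : Euc d → ℝ} (h : IsDarcySolution Ω ΓD ΓF K f g v p) :
    ∃ u ∈ dirichletSpace Ω ΓD, u.fst =ᵐ[volume.restrict Ω] p ∧
      v =ᵐ[volume.restrict Ω] -T u.snd ∧
      ∀ w ∈ dirichletSpace Ω ΓD, ⟪T u.snd, w.snd⟫_ℝ = ⟪F, w.fst⟫_ℝ := by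
  obtain ⟨t, ht⟩ := h.pressure_mem
  obtain ⟨u, hu, h1, -, h3⟩ := ht.exists_mem hΩ hΓD hΓ
  refine ⟨u, hu, h1, ?_, fun w hw => ?_⟩
  · filter_upwards [h.velocity_eq, hT u.snd, h3] with x hx1 hx2 hx3
    rw [hx1, Pi.neg_apply, hx2, hx3]
  · rw [hF w.fst w.fst w.fst (ae_eq_refl _) (ae_eq_refl _),
      inner_operator_eq_integral hT h3 (weakGrad_ae_eq_snd hΩ hw).symm]
    have := h.weak_form _ _ (isTraceVanishingOn_of_mem hΩ hΓD hΓ hw)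
    linarith

/-- Existence by the Lax–Milgram theorem, in the Dirichlet space. -/
lemma exists_variational_solution {F : Lp ℝ 2 (closureMeasure Ω)} {C lam : ℝ} (hlam : 0 < lam)
    (hP : ∀ w ∈ dirichletSpace Ω ΓD, ‖w.fst‖ ≤ C * ‖w.snd‖)
    {T : Lp (Euc d) 2 (volume.restrict Ω) →L[ℝ] Lp (Euc d) 2 (volume.restrict Ω)}
    (hT : ∀ G, lam * ‖G‖ ^ 2 ≤ ⟪T G, G⟫_ℝ) :
    ∃ u ∈ dirichletSpace Ω ΓD, ∀ w ∈ dirichletSpace Ω ΓD,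
      ⟪T u.snd, w.snd⟫_ℝ = ⟪F, w.fst⟫_ℝ := by
  have hcomplete : CompleteSpace (dirichletSpace Ω ΓD) :=
    (isClosed_dirichletSpace ΓD).completeSpace_coe
  let gr : dirichletSpace Ω ΓD →L[ℝ] Lp (Euc d) 2 (volume.restrict Ω) :=
    (WithLp.sndL 2 ℝ _ _).comp (dirichletSpace Ω ΓD).subtypeL
  let va : dirichletSpace Ω ΓD →L[ℝ] Lp ℝ 2 (closureMeasure Ω) :=
    (WithLp.fstL 2 ℝ _ _).comp (dirichletSpace Ω ΓD).subtypeL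
  let B : dirichletSpace Ω ΓD →L[ℝ] dirichletSpace Ω ΓD →L[ℝ] ℝ :=
    (isBoundedBilinearMap_inner (𝕜 := ℝ)
      (E := Lp (Euc d) 2 (volume.restrict Ω))).toContinuousLinearMap.bilinearComp (T.comp gr) gr
  have hB : IsCoercive B := by
    refine ⟨lam / (C ^ 2 + 1), by positivity, fun w => ?_⟩
    have h1 := hT (w : PairSpace Ω).snd
    have h2 : ‖w‖ ^ 2 ≤ (C ^ 2 + 1) * ‖(w : PairSpace Ω).snd‖ ^ 2 := by
      rw [← Submodule.norm_coe, WithLp.prod_norm_sq_eq_of_L2]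
      have := pow_le_pow_left₀ (norm_nonneg _) (hP w w.2) 2
      rw [mul_pow] at this
      linarith
    change _ ≤ ⟪T (w : PairSpace Ω).snd, (w : PairSpace Ω).snd⟫_ℝ
    refine le_trans ?_ h1
    rw [div_mul_eq_mul_div, div_mul_eq_mul_div, div_le_iff₀ (by positivity)]
    nlinarith
  let z := (InnerProductSpace.toDual ℝ (dirichletSpace Ω ΓD)).symm ((innerSL ℝ F).comp va)
  let u := hB.continuousLinearEquivOfBilin.symm z
  refine ⟨u, u.2, fun w hw => ?_⟩
  have h1 := hB.continuousLinearEquivOfBilin_apply u ⟨w, hw⟩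
  rw [ContinuousLinearEquiv.apply_symm_apply, InnerProductSpace.toDual_symm_apply] at h1
  exact h1.symm

theorem exists_isDarcySolution (hΩ : IsBoundedLipschitzDomain Ω) (hΓD : MeasurableSet ΓD)
    (hΓ : ΓD ⊆ frontier Ω) (hpos : closureMeasure Ω ΓD ≠ 0) {F : Lp ℝ 2 (closureMeasure Ω)}
    (hF : ∀ (u : Lp ℝ 2 (closureMeasure Ω)) (q t : Euc d → ℝ),
      u =ᵐ[volume.restrict Ω] q → u =ᵐ[(surfaceMeasure d).restrict (frontier Ω)] t →
      ⟪F, u⟫_ℝ = (∫ x in Ω, f x * q x) + ∫ x in ΓF, g x * t x ∂(surfaceMeasure d))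
    {lam Kmax : ℝ} (hlam : 0 < lam) {K : Euc d → Matrix (Fin d) (Fin d) ℝ}
    (hK : IsPermeability Ω lam Kmax K) :
    ∃ (v : Euc d → Euc d) (p : Euc d → ℝ), IsDarcySolution Ω ΓD ΓF K f g v p := by
  obtain ⟨C, -, hP⟩ := exists_norm_fst_le hΩ hpos
  obtain ⟨T, -, hTc, hT⟩ := hK.exists_operator
  obtain ⟨u, hu, hweak⟩ := exists_variational_solution (F := F) hlam hP hTc
  have hgrad := weakGrad_ae_eq_snd hΩ hu
  refine ⟨⇑(-T u.snd), u.fst, ⟨_, isTraceVanishingOn_of_mem hΩ hΓD hΓ hu⟩, fun q t hq => ?_,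
    Lp.memLp _, ?_⟩
  · obtain ⟨w, hw, h1, h2, h3⟩ := hq.exists_mem hΩ hΓD hΓ
    rw [← inner_operator_eq_integral hT hgrad.symm h3, hweak w hw, hF w.fst q t h1 h2]
    ring
  · filter_upwards [Lp.coeFn_neg (T u.snd), hT u.snd, hgrad] with x h1 h2 h3
    rw [h1, Pi.neg_apply, h2, h3]

end WeakFormulation

/-! ### Perturbation of the permeability -/

section Perturbation

variable {d : ℕ} {Ω ΓD : Set (Euc d)}

lemma norm_operator_sub_le {K₁ K₂ : Euc d → Matrix (Fin d) (Fin d) ℝ}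
    {T₁ T₂ : Lp (Euc d) 2 (volume.restrict Ω) →L[ℝ] Lp (Euc d) 2 (volume.restrict Ω)}
    (hT₁ : ∀ G, T₁ G =ᵐ[volume.restrict Ω] fun x => (K₁ x).toEuclideanLin (G x))
    (hT₂ : ∀ G, T₂ G =ᵐ[volume.restrict Ω] fun x => (K₂ x).toEuclideanLin (G x))
    (h : matLinftyNorm Ω (K₂ - K₁) ≠ ⊤) (G : Lp (Euc d) 2 (volume.restrict Ω)) :
    ‖T₂ G - T₁ G‖ ≤ (matLinftyNorm Ω (K₂ - K₁)).toReal * ‖G‖ := by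
  refine Lp.norm_le_mul_norm_of_ae_le_mul ?_
  filter_upwards [ae_frobNorm_le_toReal_matLinftyNorm h, hT₁ G, hT₂ G, Lp.coeFn_sub (T₂ G) (T₁ G)]
    with x hx h1 h2 h3
  rw [h3, Pi.sub_apply, h1, h2, ← LinearMap.sub_apply, ← map_sub]
  exact (norm_toEuclideanLin_le _ _).trans (by gcongr; exact hx)

variable {F : Lp ℝ 2 (closureMeasure Ω)} {C lam ε : ℝ}
  {T T₁ T₂ : Lp (Euc d) 2 (volume.restrict Ω) →L[ℝ] Lp (Euc d) 2 (volume.restrict Ω)}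
  {u u₁ u₂ : PairSpace Ω}

/-- The energy estimate: test the variational problem with its solution. -/
lemma norm_snd_le_of_variational (hlam : 0 < lam) (hC : 0 ≤ C)
    (hP : ∀ w ∈ dirichletSpace Ω ΓD, ‖w.fst‖ ≤ C * ‖w.snd‖)
    (hT : ∀ G, lam * ‖G‖ ^ 2 ≤ ⟪T G, G⟫_ℝ) (hu : u ∈ dirichletSpace Ω ΓD)
    (h : ⟪T u.snd, u.snd⟫_ℝ = ⟪F, u.fst⟫_ℝ) : ‖u.snd‖ ≤ ‖F‖ * C / lam := by
  rw [le_div_iff₀ hlam]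
  rcases (norm_nonneg u.snd).eq_or_lt with h0 | h0
  · rw [← h0, zero_mul]
    positivity
  · have h1 : lam * ‖u.snd‖ ^ 2 ≤ ‖F‖ * (C * ‖u.snd‖) := by
      refine (hT u.snd).trans ?_
      rw [h]
      exact (real_inner_le_norm _ _).trans (by gcongr; exact hP u hu)
    nlinarith

/-- The gradients of two solutions: test the difference of the two variational problems with the
difference of the solutions. -/
lemma norm_snd_sub_le_of_variational (hlam : 0 < lam)
    (hT₂ : ∀ G, lam * ‖G‖ ^ 2 ≤ ⟪T₂ G, G⟫_ℝ) (hε : ∀ G, ‖T₂ G - T₁ G‖ ≤ ε * ‖G‖)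
    (h : ⟪T₂ u₂.snd, (u₂ - u₁).snd⟫_ℝ = ⟪T₁ u₁.snd, (u₂ - u₁).snd⟫_ℝ) :
    ‖(u₂ - u₁).snd‖ ≤ ε * ‖u₁.snd‖ / lam := by
  rw [le_div_iff₀ hlam]
  have hε0 : 0 ≤ ε * ‖u₁.snd‖ := (norm_nonneg _).trans (hε _)
  rcases (norm_nonneg (u₂ - u₁).snd).eq_or_lt with h0 | h0
  · rwa [← h0, zero_mul]
  · have h1 : ⟪T₂ (u₂ - u₁).snd, (u₂ - u₁).snd⟫_ℝ =
        -⟪T₂ u₁.snd - T₁ u₁.snd, (u₂ - u₁).snd⟫_ℝ := by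
      have hs : T₂ (u₂ - u₁).snd = T₂ u₂.snd - T₂ u₁.snd := by rw [WithLp.sub_snd, map_sub]
      rw [hs, inner_sub_left, inner_sub_left, h]
      ring
    have h2 : lam * ‖(u₂ - u₁).snd‖ ^ 2 ≤ ε * ‖u₁.snd‖ * ‖(u₂ - u₁).snd‖ := by
      refine (hT₂ _).trans ?_
      rw [h1, ← inner_neg_left]
      refine (real_inner_le_norm _ _).trans ?_
      rw [norm_neg]
      gcongr
      exact hε _
    nlinarith

end Perturbation

theorem mainTheorem11 (d : ℕ) (Ω ΓD ΓF : Set (Euc d))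
    (hΩ : IsBoundedLipschitzDomain Ω)
    (hΓ : frontier Ω = ΓD ∪ ΓF)
    (hΓD : MeasurableSet ΓD) (hΓF : MeasurableSet ΓF)
    (hpos : 0 < surfaceMeasure d ΓD)
    (f g : Euc d → ℝ)
    (hf : MemLp f 2 (volume.restrict Ω))
    (hg : MemLp g 2 ((surfaceMeasure d).restrict ΓF))
    (lam Kmax : ℝ) (hlam : 0 < lam) :
    (∀ K : Euc d → Matrix (Fin d) (Fin d) ℝ, IsPermeability Ω lam Kmax K →
      ∃ (v : Euc d → Euc d) (p : Euc d → ℝ), IsDarcySolution Ω ΓD ΓF K f g v p) ∧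
    ∃ C : ℝ≥0, ∀ K₁ K₂ : Euc d → Matrix (Fin d) (Fin d) ℝ,
      IsPermeability Ω lam Kmax K₁ → IsPermeability Ω lam Kmax K₂ →
      ∀ (v₁ v₂ : Euc d → Euc d) (p₁ p₂ : Euc d → ℝ),
        IsDarcySolution Ω ΓD ΓF K₁ f g v₁ p₁ → IsDarcySolution Ω ΓD ΓF K₂ f g v₂ p₂ →
        h1Norm Ω (p₂ - p₁) ≤ C * matLinftyNorm Ω (K₂ - K₁) ∧
        eLpNorm (v₂ - v₁) 2 (volume.restrict Ω) ≤ C * matLinftyNorm Ω (K₂ - K₁) := by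
  have hD : ΓD ⊆ frontier Ω := hΓ ▸ Set.subset_union_left
  have hpos' : closureMeasure Ω ΓD ≠ 0 := by
    have h := closureMeasure_restrict_of_subset_frontier hΩ.isOpen hΓD hD
    rw [← Measure.restrict_apply_self, h, Measure.restrict_apply_self]
    exact hpos.ne'
  obtain ⟨F, hF⟩ := exists_load hΩ.isOpen hΓF (hΓ ▸ Set.subset_union_right) hf hg
  refine ⟨fun K hK => exists_isDarcySolution hΩ hΓD hD hpos' hF hlam hK, ?_⟩
  obtain ⟨C, hC, hP⟩ := exists_norm_fst_le hΩ hpos'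
  -- `M` bounds the gradients of all solutions, `(C + 1) * M / lam` and `(|Kmax| / lam + 1) * M`
  -- are constants for the pressure and for the velocity, and their sum serves both.
  set M : ℝ := ‖F‖ * C / lam with hM
  have hM0 : 0 ≤ M := by positivity
  refine ⟨((C + 1) * (M / lam) + (|Kmax| * (M / lam) + M)).toNNReal, ?_⟩
  intro K₁ K₂ hK₁ hK₂ v₁ v₂ p₁ p₂ hs₁ hs₂
  obtain ⟨T₁, -, hc₁, hT₁⟩ := hK₁.exists_operator
  obtain ⟨T₂, hb₂, hc₂, hT₂⟩ := hK₂.exists_operator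
  obtain ⟨u₁, hu₁, hp₁, hv₁, hw₁⟩ := hs₁.exists_mem hΩ hΓD hD hF hT₁
  obtain ⟨u₂, hu₂, hp₂, hv₂, hw₂⟩ := hs₂.exists_mem hΩ hΓD hD hF hT₂
  have htop := hK₁.matLinftyNorm_sub_ne_top hK₂
  have hε := norm_operator_sub_le hT₁ hT₂ htop
  rw [← ENNReal.ofReal_toReal htop, ENNReal.ofNNReal_toNNReal, ← ENNReal.ofReal_mul (by positivity)]
  set ε := (matLinftyNorm Ω (K₂ - K₁)).toReal
  have hε0 : 0 ≤ ε := ENNReal.toReal_nonneg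
  have hu : u₂ - u₁ ∈ dirichletSpace Ω ΓD := Submodule.sub_mem _ hu₂ hu₁
  have hM₁ : ‖u₁.snd‖ ≤ M := norm_snd_le_of_variational hlam hC hP hc₁ hu₁ (hw₁ u₁ hu₁)
  have hG : ‖(u₂ - u₁).snd‖ ≤ M / lam * ε := by
    refine (norm_snd_sub_le_of_variational hlam hc₂ hε
      ((hw₂ _ hu).trans (hw₁ _ hu).symm)).trans ?_
    rw [div_mul_eq_mul_div, mul_comm M]
    gcongr
  have hMl : 0 ≤ M / lam := by positivity
  constructor
  · have hp : p₂ - p₁ =ᵐ[volume.restrict Ω] (u₂ - u₁).fst :=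
      (hp₂.symm.sub hp₁.symm).trans
        (ae_eq_restrict_of_closureMeasure (Lp.coeFn_sub u₂.fst u₁.fst)).symm
    refine (h1Norm_le_enorm hΩ hu.1 hp).trans ?_
    rw [← ofReal_norm]
    refine ENNReal.ofReal_le_ofReal ?_
    have h1 : ‖u₂ - u₁‖ ≤ ‖(u₂ - u₁).fst‖ + ‖(u₂ - u₁).snd‖ := by
      refine abs_le_of_sq_le_sq' ?_ (by positivity) |>.2
      rw [WithLp.prod_norm_sq_eq_of_L2]
      nlinarith [norm_nonneg (u₂ - u₁).fst, norm_nonneg (u₂ - u₁).snd]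
    calc ‖u₂ - u₁‖ ≤ C * ‖(u₂ - u₁).snd‖ + ‖(u₂ - u₁).snd‖ := by
          linarith [hP _ hu]
      _ = (C + 1) * ‖(u₂ - u₁).snd‖ := by ring
      _ ≤ (C + 1) * (M / lam * ε) := by gcongr
      _ ≤ _ := by
          have : 0 ≤ (|Kmax| * (M / lam) + M) * ε := by positivity
          linarith
  · have hv : v₂ - v₁ =ᵐ[volume.restrict Ω] -(T₂ u₂.snd - T₁ u₁.snd) := by
      filter_upwards [hv₁, hv₂] with x h1 h2
      simp only [Pi.sub_apply, Pi.neg_apply, h1, h2]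
      abel
    rw [eLpNorm_congr_ae hv, eLpNorm_neg, ← eLpNorm_congr_ae (Lp.coeFn_sub _ _), ← Lp.enorm_def,
      ← ofReal_norm]
    refine ENNReal.ofReal_le_ofReal ?_
    have hs : T₂ u₂.snd - T₁ u₁.snd = T₂ (u₂ - u₁).snd + (T₂ u₁.snd - T₁ u₁.snd) := by
      rw [WithLp.sub_snd, map_sub]
      abel
    calc ‖T₂ u₂.snd - T₁ u₁.snd‖ ≤ |Kmax| * ‖(u₂ - u₁).snd‖ + ε * ‖u₁.snd‖ := by
          rw [hs]
          exact (norm_add_le _ _).trans (add_le_add (hb₂ _) (hε _))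
      _ ≤ |Kmax| * (M / lam * ε) + ε * M := by gcongr
      _ ≤ _ := by
          have : 0 ≤ (C + 1) * (M / lam) * ε := by positivity
          linarith
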